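/- Let $(X,d)$ be a complete metric space with at least two points. Write $B(x,r)$ for open balls. Assume that $(X,d)$ is doubling (there is $N\in\mathbb N$ such that every ball $B(x,2r)$, $x\in X$, $r>0$, is covered by $N$ balls of radius $r$) and uniformly perfect (there is $\gamma>1$ such that $B(x,\gamma r)\setminus B(x,r)\neq\emptyset$ whenever $x\in X$, $r>0$ and $B(x,r)\ne X$). Then there exist a tree with a reference point $(T,\pi,\phi)$ and a partition $K$ of $(X,d)$ parametrized by it such that $d$ satisfies the basic framework with respect to $K$. Here the notions are as follows. **Tree with a reference point.** $T$ is a countable set and $\pi:T\to T$ is a map such that $F_\pi=\{w\in T\mid \pi^n(w)=w\text{ for some }n\ge1\}$ has at most one element, and for all $w,v\in T$ there are $n,m\ge0$ with $\pi^n(w)=\pi^m(v)$; moreover $\phi\in T$, and $\phi\in F_\pi$ if $F_\pi\ne\emptyset$. Put $b(w,v)=\min\{n\ge0\mid \pi^n(w)=\pi^m(v)\text{ for some }m\ge0\}$, $[w]=b(w,\phi)-b(\phi,w)\in\mathbb Z$ and $(T)_k=\{w\in T\mid[w]=k\}$. **Partition.** $X$ is $\sigma$-compact and has no isolated points, and $K$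 assigns to each $w\in T$ a compact set $K_w\subset X$ with at least two points, such that - $\bigcup_{w\in(T)_0}K_w=X$, and $\bigcup_{v\in\pi^{-1}(w)\setminus\{w\}}K_v=K_w$ for every $w\in T$; - for every sequence $(w_k)_{k\in\mathbb Z}$ in $T$ with $\pi(w_{k+1})=w_k$ for all $k$, other than the constant sequence $w_k=\phi$ (which occurs only if $F_\pi\neq\emptyset$), the set $\bigcap_{k\in\mathbb Z}K_{w_k}$ is a single point. **Notation.** Let $g(w)=\operatorname{diam}(K_w,d)$. For $s>0$ let $\Lambda_s=\{\phi\}$ if $F_\pi\ne\emptyset$ and $s\ge g(\phi)$, and $\Lambda_s=\{w\in T\mid g(w)\le s<g(\pi(w))\}$ otherwise. Let $l_s$ be the graph distance (possibly $\infty$) of the graph with vertex set $\Lambda_s$ in which $w\ne v$ are adjacent if and only if $K_w\cap K_v\neq\emptyset$. For $M\ge1$ let $$\delta_M(x,y)=\inf\{s>0\mid \text{there are }w,v\in\Lambda_s\text{ with }x\in K_w,\ y\in K_v,\ l_s(w,v)\le M\},\qquad \inf\emptyset=\infty.$$ **Basic framework.** The metric $d$ satisfies the basic framework with respect to $K$ if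 $\sup_{w\in T}\#\pi^{-1}(w)<\infty$; for every $w\in T$, $K_w\setminus\bigcup_{v\in(T)_{[w]},\,v\ne w}K_v\ne\emptyset$ and there is an open set $U_w\supset K_w$ with $\#\{v\in(T)_{[w]}\mid U_w\cap K_v\ne\emptyset\}<\infty$; and - (adapted) there are an integer $M\ge1$ and $\eta_1>0$ with $\eta_1^{-1}\delta_M(x,y)\le d(x,y)\le\eta_1\delta_M(x,y)$ for all $x,y\in X$; - (thick) there is $\eta_2>0$ such that for every $w\in T$ there is $x_w\in K_w$ with $\{y\in X\mid\delta_1(x_w,y)\le\eta_2\,g(\pi(w))\}\subset K_w$; - (uniformly finite) $\sup_{s>0,\ w\in\Lambda_s}\#\{v\in\Lambda_s\mid l_s(w,v)\le1\}<\infty$; - there are $\eta_3>0$ and $r\in(0,1)$ with $\eta_3^{-1}r^{[w]}\le g(w)\le\eta_3r^{[w]}$ for all $w\in T$. -/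

import Mathlib

/-- A metric space is doubling if for some `N` every ball of radius `2 * r` is covered by (at most)
`N` balls of radius `r`. -/
def DoublingSpace (X : Type*) [MetricSpace X] : Prop :=
  ∃ N : ℕ, ∀ (x : X) (r : ℝ), 0 < r →
    ∃ A : Finset X, A.card ≤ N ∧ Metric.ball x (2 * r) ⊆ ⋃ y ∈ A, Metric.ball y r

/-- A metric space is uniformly perfect if for some `γ > 1` the set `B(x, γ r) \ B(x, r)` is
non-empty whenever `B(x, r) ≠ X`. -/
def UniformlyPerfectSpace (X : Type*) [MetricSpace X] : Prop :=
  ∃ γ : ℝ, 1 < γ ∧ ∀ (x : X) (r : ℝ), 0 < r → Metric.ball x r ≠ Set.univ →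
    (Metric.ball x (γ * r) \ Metric.ball x r).Nonempty

/-- A tree with a reference point `(T, π, φ)`. The set `F_π` of the points `w` with `π^n(w) = w` for
some `n ≥ 1` is `Function.periodicPts π`. -/
structure RefTree (T : Type*) where
  /-- The parent map. -/
  π : T → T
  /-- The reference point. -/
  φ : T
  countable : Countable T
  periodicPts_subsingleton : (Function.periodicPts π).Subsingleton
  exists_common_ancestor : ∀ w v : T, ∃ n m : ℕ, π^[n] w = π^[m] v
  φ_mem : (Function.periodicPts π).Nonempty → φ ∈ Function.periodicPts π

namespace RefTree

variable {T : Type*} (𝒯 : RefTree T)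

/-- `b(w, v)`, the least `n` such that `π^n(w)` is an iterated image of `v`. -/
noncomputable def b (w v : T) : ℕ :=
  sInf {n : ℕ | ∃ m : ℕ, 𝒯.π^[n] w = 𝒯.π^[m] v}

/-- The level `[w] = b(w, φ) - b(φ, w)`. -/
noncomputable def level (w : T) : ℤ :=
  (𝒯.b w 𝒯.φ : ℤ) - (𝒯.b 𝒯.φ w : ℤ)

/-- `K` is a partition of `Y` parametrized by the tree. If `π` has a fixed point then this point is
`φ`; it is not counted as one of its own children, and the constant sequence `w_k = φ` is not one of
the sequences whose sets shrink to a point. -/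
structure IsPartition {Y : Type*} [MetricSpace Y] (K : T → Set Y) : Prop where
  sigmaCompact : SigmaCompactSpace Y
  perfect : PerfectSpace Y
  isCompact : ∀ w, IsCompact (K w)
  /-- `K w` has at least two points. -/
  nontrivial : ∀ w, (K w).Nontrivial
  iUnion_level_zero : ⋃ w ∈ {w : T | 𝒯.level w = 0}, K w = Set.univ
  iUnion_children : ∀ w, ⋃ v ∈ {v : T | 𝒯.π v = w ∧ v ≠ w}, K v = K w
  iInter_branch : ∀ w : ℤ → T, (∀ k, 𝒯.π (w (k + 1)) = w k) → (∃ k, w k ≠ 𝒯.φ) →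
    ∃ x : Y, ⋂ k, K (w k) = {x}

variable {Y : Type*} [MetricSpace Y] (K : T → Set Y)

open Classical in
/-- The scale-`s` cut `Λ_s` of the tree with respect to the diameters of the sets `K w`. -/
noncomputable def cut (s : ℝ) : Set T :=
  if (Function.periodicPts 𝒯.π).Nonempty ∧ Metric.diam (K 𝒯.φ) ≤ s then {𝒯.φ}
  else {w | Metric.diam (K w) ≤ s ∧ s < Metric.diam (K (𝒯.π w))}

/-- The graph `(Λ_s, E_s)`: two distinct vertices are adjacent if their sets intersect. -/
def cutGraph (s : ℝ) : SimpleGraph (𝒯.cut K s) where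
  Adj w v := w ≠ v ∧ (K w ∩ K v).Nonempty
  symm := ⟨fun _ _ h => ⟨h.1.symm, by rw [Set.inter_comm]; exact h.2⟩⟩
  loopless := ⟨fun _ h => h.1 rfl⟩

/-- `δ_M(x, y)`, with the value `∞` if there is no admissible `s`; the graph distance `edist` takes
the value `∞` between different components. -/
noncomputable def chainDist (M : ℕ) (x y : Y) : ENNReal :=
  ⨅ (s : ℝ) (_ : 0 < s ∧ ∃ w v : 𝒯.cut K s, x ∈ K w ∧ y ∈ K v ∧ (𝒯.cutGraph K s).edist w v ≤ M),
    ENNReal.ofReal s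

/-- The metric of `Y` satisfies the basic framework with respect to the partition `K`, including the
standing conditions on the tree and on `K` under which this is defined. -/
structure BasicFramework : Prop where
  children_bounded : ∃ N : ℕ, ∀ w, {v | 𝒯.π v = w}.encard ≤ N
  minimal : ∀ w, (K w \ ⋃ v ∈ {v : T | 𝒯.level v = 𝒯.level w ∧ v ≠ w}, K v).Nonempty
  locallyFinite : ∀ w, ∃ U : Set Y, IsOpen U ∧ K w ⊆ U ∧
    {v | 𝒯.level v = 𝒯.level w ∧ (U ∩ K v).Nonempty}.Finite
  adapted : ∃ (M : ℕ) (η : ℝ), 1 ≤ M ∧ 0 < η ∧ ∀ x y : Y,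
    ENNReal.ofReal η⁻¹ * 𝒯.chainDist K M x y ≤ edist x y ∧
      edist x y ≤ ENNReal.ofReal η * 𝒯.chainDist K M x y
  thick : ∃ η : ℝ, 0 < η ∧ ∀ w, ∃ x ∈ K w,
    {y | 𝒯.chainDist K 1 x y ≤ ENNReal.ofReal (η * Metric.diam (K (𝒯.π w)))} ⊆ K w
  uniformlyFinite : ∃ N : ℕ, ∀ s : ℝ, 0 < s → ∀ w : 𝒯.cut K s,
    {v : 𝒯.cut K s | (𝒯.cutGraph K s).edist w v ≤ 1}.encard ≤ N
  diam_comparable : ∃ η r : ℝ, 0 < η ∧ 0 < r ∧ r < 1 ∧ ∀ w,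
    η⁻¹ * r ^ 𝒯.level w ≤ Metric.diam (K w) ∧ Metric.diam (K w) ≤ η * r ^ 𝒯.level w

end RefTree

/-! The sets `K w` are closed dyadic cubes in the manner of Christ. Fix a small ratio `r`, choose a
net `A k` of scale `R * r ^ k` for each level `k`, let the vertices of the tree be the net points
with their levels, and let the cube of `w` be the set of limits of centers of descendants of `w`.
Doubling makes every count finite and uniform; uniform perfectness bounds diameters from below. If
each net point very close to `w` is a child of `w`, the cube of `w` contains a ball about its center
that avoids the other cubes of its level (`dist_center_ge`, `ball_subset_cube`). This yields
thickness, minimality, and, through the separation of centers in a cut (`cut_separated`), uniform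
finiteness.

The difficulty is adaptedness: `δ_M` sees only cubes that really intersect, and in a disconnected
space neighbouring cubes need not touch. The parent map is therefore rigged (`exists_parent_map`).
For each ordered pair `(z', z)` of neighbouring net points, two neighbouring points of the finer net
are reserved in an annulus about `z'`; one is handed to `z`, the other stays with `z'`. Neighbouring
vertices thus have neighbouring children, and by iteration their cubes are at distance zero, so by
compactness they meet (`inter_nonempty`). Annuli of different sizes, indexed by the boundedly many
neighbours of `z'`, keep the reservations from colliding. The price is that a parent may be as far
as `(C + 1)` times the scale, with `C = 3 * γ`, which a small `r` absorbs.

Any two points at a distance comparable to a scale are then joined by four consecutively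
intersecting cubes of that scale, so `M = 3` works. The tree is rooted exactly when `X` is bounded.
Otherwise one point common to all nets forces common ancestors (`eventually_iterate_eq`). -/

/-! ### Nets, packing, and consequences of doubling and uniform perfectness -/

/-- A `ρ`-separated subset of a metric space that meets every closed ball of radius `ρ`. -/
structure IsNet {X : Type*} [MetricSpace X] (A : Set X) (ρ : ℝ) : Prop where
  sep : ∀ x ∈ A, ∀ y ∈ A, x ≠ y → ρ ≤ dist x y
  cover : ∀ x, ∃ z ∈ A, dist x z ≤ ρ

theorem exists_isNet {X : Type*} [MetricSpace X] (x₀ : X) {ρ : ℝ} (hρ : 0 < ρ) :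
    ∃ A : Set X, x₀ ∈ A ∧ IsNet A ρ := by
  obtain ⟨A, hA, hmax⟩ := zorn_subset_nonempty
    {A : Set X | ∀ x ∈ A, ∀ y ∈ A, x ≠ y → ρ ≤ dist x y} (by
      intro c hc hchain _
      refine ⟨⋃₀ c, ?_, fun s hs => Set.subset_sUnion_of_mem hs⟩
      rintro x ⟨s, hs, hxs⟩ y ⟨t, ht, hyt⟩ hxy
      rcases hchain.total hs ht with h | h
      · exact hc ht x (h hxs) y hyt hxy
      · exact hc hs x hxs y (h hyt) hxy) {x₀} (by simp)
  refine ⟨A, hA rfl, hmax.prop, fun x => ?_⟩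
  by_contra! h
  have hx : insert x A ⊆ A := hmax.le_of_ge (by
    rintro y (rfl | hy) z (rfl | hz) hyz
    · exact absurd rfl hyz
    · exact (h z hz).le
    · rw [dist_comm]; exact (h y hy).le
    · exact hmax.prop y hy z hz hyz) (Set.subset_insert x A)
  have := h x (hx (Set.mem_insert x A))
  rw [dist_self] at this
  linarith

namespace DoublingSpace

variable {X : Type*} [MetricSpace X]

theorem exists_finset_cover {N : ℕ} (hN : ∀ (x : X) (r : ℝ), 0 < r →
      ∃ A : Finset X, A.card ≤ N ∧ Metric.ball x (2 * r) ⊆ ⋃ y ∈ A, Metric.ball y r)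
    (j : ℕ) (x : X) {ρ : ℝ} (hρ : 0 < ρ) : ∃ A : Finset X, A.card ≤ N ^ j ∧
      Metric.ball x (2 ^ j * ρ) ⊆ ⋃ y ∈ A, Metric.ball y ρ := by
  induction j generalizing x with
  | zero => exact ⟨{x}, by simp, by simp⟩
  | succ j ih =>
    classical
    obtain ⟨A, hAN, hA⟩ := hN x (2 ^ j * ρ) (by positivity)
    choose B hBN hB using ih
    refine ⟨A.biUnion B, ?_, fun z hz => ?_⟩
    · calc _ ≤ A.card * N ^ j := Finset.card_biUnion_le_card_mul _ _ _ fun y _ => hBN y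
        _ ≤ N * N ^ j := Nat.mul_le_mul_right _ hAN
        _ = N ^ (j + 1) := (pow_succ' N j).symm
    · rw [pow_succ', mul_assoc] at hz
      obtain ⟨y, hy, hzy⟩ := Set.mem_iUnion₂.1 (hA hz)
      obtain ⟨y', hy', hzy'⟩ := Set.mem_iUnion₂.1 (hB y hzy)
      exact Set.mem_iUnion₂.2 ⟨y', Finset.mem_biUnion.2 ⟨y, hy, hy'⟩, hzy'⟩

theorem properSpace [CompleteSpace X] (hd : DoublingSpace X) : ProperSpace X where
  isCompact_closedBall x R := by
    refine TotallyBounded.isCompact_of_isClosed (Metric.totallyBounded_iff.2 fun ε hε => ?_)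
      Metric.isClosed_closedBall
    obtain ⟨N, hN⟩ := hd
    obtain ⟨j, hj⟩ := pow_unbounded_of_one_lt (R / ε) (one_lt_two : (1 : ℝ) < 2)
    obtain ⟨A, -, hA⟩ := exists_finset_cover hN j x hε
    exact ⟨A, A.finite_toSet, (Metric.closedBall_subset_ball ((div_lt_iff₀ hε).1 hj)).trans
      (by simpa using hA)⟩

/-- A `ρ`-separated family in a ball of radius `Λ * ρ` has a number of members bounded in terms
of `Λ`. -/
theorem exists_packing_bound (hd : DoublingSpace X) (Λ : ℝ) : ∃ P : ℕ,
    ∀ (x : X) (ρ : ℝ), 0 < ρ → ∀ S : Set X, (∀ y ∈ S, dist y x ≤ Λ * ρ) →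
      (∀ y ∈ S, ∀ z ∈ S, y ≠ z → ρ ≤ dist y z) → S.encard ≤ P := by
  obtain ⟨N, hN⟩ := hd
  obtain ⟨j, hj⟩ := pow_unbounded_of_one_lt (2 * Λ) (one_lt_two : (1 : ℝ) < 2)
  refine ⟨N ^ j, fun x ρ hρ S hS hsep => ?_⟩
  obtain ⟨A, hAN, hA⟩ := exists_finset_cover hN j x (half_pos hρ)
  have hmem : ∀ y ∈ S, ∃ z ∈ A, dist y z < ρ / 2 := by
    intro y hy
    have : y ∈ Metric.ball x (2 ^ j * (ρ / 2)) := by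
      have := hS y hy
      rw [Metric.mem_ball]
      nlinarith
    simpa using hA this
  choose! f hfA hf using hmem
  have hinj : Set.InjOn f S := by
    intro y hy z hz hyz
    by_contra hne
    have h1 := hf y hy
    have h2 := hf z hz
    rw [← hyz] at h2
    linarith [hsep y hy z hz hne, dist_triangle_right y z (f y)]
  calc S.encard ≤ (A : Set X).encard := Set.encard_le_encard_of_injOn (fun y hy => hfA y hy) hinj
    _ = A.card := Set.encard_coe_eq_coe_finsetCard A
    _ ≤ (N ^ j : ℕ) := by exact_mod_cast hAN

end DoublingSpace

theorem Set.encard_le_of_separated_family {X T : Type*} [MetricSpace X] {Λ ρ : ℝ} {P : ℕ} {x : X}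
    (hP : ∀ S : Set X, (∀ y ∈ S, dist y x ≤ Λ * ρ) →
      (∀ y ∈ S, ∀ z ∈ S, y ≠ z → ρ ≤ dist y z) → S.encard ≤ P)
    (hρ : 0 < ρ) (c : T → X) (S : Set T) (hS : ∀ v ∈ S, dist (c v) x ≤ Λ * ρ)
    (hsep : ∀ v ∈ S, ∀ w ∈ S, v ≠ w → ρ ≤ dist (c v) (c w)) : S.encard ≤ P := by
  have hinj : Set.InjOn c S := by
    intro v hv w hw h
    by_contra hne
    have := hsep v hv w hw hne
    rw [h, dist_self] at this
    linarith
  rw [← hinj.encard_image]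
  refine hP _ ?_ ?_
  · rintro _ ⟨v, hv, rfl⟩
    exact hS v hv
  · rintro _ ⟨v, hv, rfl⟩ _ ⟨w, hw, rfl⟩ h
    exact hsep v hv w hw (fun h' => h (h' ▸ rfl))

theorem IsNet.countable {X : Type*} [MetricSpace X] [TopologicalSpace.SeparableSpace X] {A : Set X}
    {ρ : ℝ} (hA : IsNet A ρ) (hρ : 0 < ρ) : A.Countable := by
  refine Set.PairwiseDisjoint.countable_of_isOpen (s := fun x => Metric.ball x (ρ / 2)) ?_
    (fun _ _ => Metric.isOpen_ball) (fun x _ => ⟨x, Metric.mem_ball_self (by linarith)⟩)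
  intro x hx y hy hxy
  exact Metric.ball_disjoint_ball (by linarith [hA.sep x hx y hy hxy])

theorem UniformlyPerfectSpace.perfectSpace {X : Type*} [MetricSpace X] [Nontrivial X]
    (hu : UniformlyPerfectSpace X) : PerfectSpace X := by
  obtain ⟨γ, hγ, hu⟩ := hu
  refine perfectSpace_iff_forall_not_isolated.2 fun x => ?_
  rw [← mem_closure_iff_nhdsWithin_neBot, Metric.mem_closure_iff]
  intro ε hε
  obtain ⟨y, hy⟩ := exists_ne x
  have hxy := dist_pos.2 hy
  have hm : 0 < min ε (dist y x) := lt_min hε hxy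
  have hγ0 : 0 < γ := by linarith
  -- Dividing the radius by `γ` puts the point found in the annulus inside the ball of radius `ε`.
  obtain ⟨z, hz, hz'⟩ := hu x (min ε (dist y x) / γ) (by positivity) (by
    intro h
    have : y ∈ Metric.ball x (min ε (dist y x) / γ) := h ▸ Set.mem_univ y
    rw [Metric.mem_ball, lt_div_iff₀ hγ0] at this
    nlinarith [min_le_right ε (dist y x)])
  rw [Metric.mem_ball, mul_div_cancel₀ _ hγ0.ne'] at hz
  refine ⟨z, ?_, ?_⟩
  · rintro rfl
    exact hz' (Metric.mem_ball_self (by positivity))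
  · rw [dist_comm]; exact hz.trans_le (min_le_left _ _)

/-! ### The rigged parent map -/

/-- A sufficiently fine net has two nearby points in an annulus around a given point. -/
theorem IsNet.exists_pair_in_annulus {X : Type*} [MetricSpace X] {γ : ℝ} (hγ : 1 < γ)
    (hu : ∀ (x : X) (r : ℝ), 0 < r → Metric.ball x r ≠ Set.univ →
      (Metric.ball x (γ * r) \ Metric.ball x r).Nonempty)
    {B : Set X} {σ t : ℝ} (hB : IsNet B σ) (hσ : 0 < σ) (hσt : 16 * ((3 * γ + 1) * σ) ≤ t)
    {z z' : X} (hzz' : t ≤ dist z z') :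
    ∃ u ∈ B, ∃ u' ∈ B, u ≠ u' ∧ dist u u' ≤ 3 * γ * σ ∧
      7 / 8 * t ≤ dist u z' ∧ dist u z' ≤ (γ + 1 / 8) * t ∧
      7 / 8 * t ≤ dist u' z' ∧ dist u' z' ≤ (γ + 1 / 8) * t := by
  have ht : 0 < t := by nlinarith
  obtain ⟨q, hq1, hq2⟩ := hu z' t ht (fun h => by
    have : z ∈ Metric.ball z' t := h ▸ Set.mem_univ z
    rw [Metric.mem_ball] at this
    linarith)
  rw [Metric.mem_ball] at hq1
  rw [Metric.mem_ball, not_lt] at hq2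
  obtain ⟨u, huB, hqu⟩ := hB.cover q
  have hσγ : σ < γ * σ := by nlinarith
  have huz : t - σ ≤ dist u z' := by linarith [dist_triangle q u z']
  have huz' : dist u z' ≤ γ * t + σ := by linarith [dist_triangle_left u z' q]
  -- The inner radius `2 * σ` exceeds the covering radius, so the net point near `y` differs from
  -- `u`; the outer one gives `2 * γ * σ + σ ≤ 3 * γ * σ`.
  obtain ⟨y, hy1, hy2⟩ := hu u (2 * σ) (by linarith) (fun h => by
    have : z' ∈ Metric.ball u (2 * σ) := h ▸ Set.mem_univ z'
    rw [Metric.mem_ball, dist_comm] at this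
    nlinarith)
  rw [Metric.mem_ball] at hy1
  rw [Metric.mem_ball, not_lt] at hy2
  obtain ⟨u', huB', hyu⟩ := hB.cover y
  have huu : dist u u' ≤ 3 * γ * σ := by
    linarith [dist_triangle_left u u' y]
  refine ⟨u, huB, u', huB', ?_, huu, by linarith, by linarith, ?_, ?_⟩
  · rintro rfl
    linarith
  · linarith [dist_triangle u u' z']
  · linarith [dist_triangle_left u' z' u, hσγ, hqu, hyu, huu, huz]

/-- The parent map between two consecutive nets. Besides the usual properties (a child is close to
its parent, and a point very close to a net point is its child), every two nearby net points have
nearby children. -/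
theorem exists_parent_map {X : Type*} [MetricSpace X] {γ : ℝ} (hγ : 1 < γ)
    (hu : ∀ (x : X) (r : ℝ), 0 < r → Metric.ball x r ≠ Set.univ →
      (Metric.ball x (γ * r) \ Metric.ball x r).Nonempty) (hd : DoublingSpace X) :
    ∃ a : ℝ, 0 < a ∧ a ≤ 1 / 8 ∧ ∀ r ρ : ℝ, 0 < r → 8 * ((3 * γ + 1) * r) ≤ a → 0 < ρ →
      ∀ A B : Set X, IsNet A ρ → IsNet B (r * ρ) → ∃ p : X → X,
        (∀ u ∈ B, p u ∈ A) ∧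
        (∀ u ∈ B, ∃ w ∈ A, dist u w ≤ ρ ∧ dist w (p u) ≤ 3 * γ * ρ) ∧
        (∀ u ∈ B, ∀ w ∈ A, dist u w < a * ρ → p u = w) ∧
        (∀ z ∈ A, ∀ z' ∈ A, z ≠ z' → dist z z' ≤ 3 * γ * ρ →
          ∃ u ∈ B, ∃ u' ∈ B, p u = z ∧ p u' = z' ∧ dist u u' ≤ 3 * γ * (r * ρ)) := by
  classical
  obtain ⟨P, hP⟩ := hd.exists_packing_bound (3 * γ)
  have hγ0 : 0 < γ := by linarith
  -- Radii of the reserved annuli in units of `ρ`. The ratio `1 / (2 * γ)` makes the bands `[7/8 * τ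
  -- i, (γ + 1/8) * τ i]` disjoint, and the factor `1 / (4 * γ)` keeps them within `1 / 2` of their
  -- center, hence away from bands about other net points.
  set τ : ℕ → ℝ := fun i => (1 / (2 * γ)) ^ i / (4 * γ) with hτ
  have hτ0 : ∀ i, 0 < τ i := fun i => by positivity
  have hq1 : 1 / (2 * γ) ≤ 1 := by rw [div_le_one (by positivity)]; linarith
  have hτanti : ∀ i j, i ≤ j → τ j ≤ τ i := fun i j hij => by
    simp only [hτ]
    gcongr ?_ / _
    exact pow_le_pow_of_le_one (by positivity) hq1 hij
  have hτsucc : ∀ i, γ * τ (i + 1) = τ i / 2 := fun i => by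
    simp only [hτ, pow_succ]
    field_simp
  have hτγ : ∀ i, γ * τ i ≤ 1 / 4 := fun i => by
    have : τ i ≤ τ 0 := hτanti 0 i (Nat.zero_le i)
    calc γ * τ i ≤ γ * τ 0 := by gcongr
      _ = 1 / 4 := by simp only [hτ, pow_zero]; field_simp
  have hτ4 : ∀ i, τ i < 1 / 4 := fun i => by nlinarith [hτγ i, hτ0 i]
  have hband : ∀ i j, i < j → (γ + 1 / 8) * τ j < 7 / 8 * τ i := fun i j hij => by
    have h1 : τ j ≤ τ (i + 1) := hτanti _ _ hij
    have h2 := hτsucc i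
    have h3 := hτ0 i
    have h4 : γ * τ j ≤ γ * τ (i + 1) := by gcongr
    have h5 : τ j ≤ τ i := hτanti _ _ hij.le
    nlinarith
  -- All bands in use have index at most `P`, so the ball of radius `τ P / 2 * ρ` about a net point
  -- lies inside all of them and contains no reserved point.
  refine ⟨τ P / 2, by have := hτ0 P; linarith, by have := hτ4 P; linarith, ?_⟩
  intro r ρ hr hra hρ A B hA hB
  have hidx : ∀ z', ∃ f : X → ℕ, z' ∈ A →
      (∀ z ∈ A, dist z z' ≤ 3 * γ * ρ → f z < P) ∧
      (∀ z ∈ A, dist z z' ≤ 3 * γ * ρ → ∀ y ∈ A, dist y z' ≤ 3 * γ * ρ → f z = f y → z = y) := by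
    intro z'
    have hcard := hP z' ρ hρ {z | z ∈ A ∧ dist z z' ≤ 3 * γ * ρ} (fun y hy => hy.2)
      (fun y hy z hz h => hA.sep y hy.1 z hz.1 h)
    have hfin := Set.finite_of_encard_le_coe hcard
    obtain ⟨f, hf, hinj⟩ := hfin.exists_injOn_of_encard_le (t := (Finset.range P : Set ℕ))
      (by rw [Set.encard_coe_eq_coe_finsetCard, Finset.card_range]; exact hcard)
    exact ⟨f, fun _ => ⟨fun z hz hzz => by simpa using hf ⟨hz, hzz⟩,
      fun z hz hzz y hy hyz h => hinj ⟨hz, hzz⟩ ⟨hy, hyz⟩ h⟩⟩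
  choose idx hidx using hidx
  let Nbr : X → X → Prop := fun z' z => z' ∈ A ∧ z ∈ A ∧ z ≠ z' ∧ dist z z' ≤ 3 * γ * ρ
  have hpair : ∀ z' z, Nbr z' z → ∃ u ∈ B, ∃ u' ∈ B, u ≠ u' ∧ dist u u' ≤ 3 * γ * (r * ρ) ∧
      7 / 8 * (τ (idx z' z) * ρ) ≤ dist u z' ∧ dist u z' ≤ (γ + 1 / 8) * (τ (idx z' z) * ρ) ∧
      7 / 8 * (τ (idx z' z) * ρ) ≤ dist u' z' ∧
      dist u' z' ≤ (γ + 1 / 8) * (τ (idx z' z) * ρ) := by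
    rintro z' z ⟨hz', hz, hne, hzz⟩
    have hi := (hidx z' hz').1 z hz hzz
    refine hB.exists_pair_in_annulus hγ hu (mul_pos hr hρ) (z := z) ?_ ?_
    · have := hτanti _ _ hi.le
      calc 16 * ((3 * γ + 1) * (r * ρ)) = 2 * (8 * ((3 * γ + 1) * r)) * ρ := by ring
        _ ≤ 2 * (τ P / 2) * ρ := by gcongr
        _ = τ P * ρ := by ring
        _ ≤ τ (idx z' z) * ρ := by gcongr
    · have := hA.sep z hz z' hz' hne
      nlinarith [hτ4 (idx z' z)]
  choose! U hUB U' hUB' hUU hUd hU1 hU2 hU1' hU2' using hpair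
  have hsmall : ∀ i, (γ + 1 / 8) * (τ i * ρ) < ρ / 2 := fun i => by
    have h1 := hτγ i
    have h2 := hτ4 i
    calc (γ + 1 / 8) * (τ i * ρ) = (γ * τ i + τ i / 8) * ρ := by ring
      _ < (1 / 2) * ρ := by gcongr; linarith
      _ = ρ / 2 := by ring
  have hnear : ∀ u, ∀ w ∈ A, ∀ w' ∈ A, dist u w < ρ / 2 → dist u w' < ρ / 2 → w = w' := by
    intro u w hw w' hw' h1 h2
    by_contra hne
    linarith [hA.sep w hw w' hw' hne, dist_triangle_left w w' u]
  have hidx_eq : ∀ i j d, 7 / 8 * (τ i * ρ) ≤ d → d ≤ (γ + 1 / 8) * (τ i * ρ) →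
      7 / 8 * (τ j * ρ) ≤ d → d ≤ (γ + 1 / 8) * (τ j * ρ) → i = j := by
    intro i j d h1 h2 h3 h4
    rcases lt_trichotomy i j with h | h | h
    · nlinarith [hband i j h]
    · exact h
    · nlinarith [hband j i h]
  have hinj : ∀ z' z y' y, Nbr z' z → Nbr y' y → ∀ u,
      7 / 8 * (τ (idx z' z) * ρ) ≤ dist u z' → dist u z' ≤ (γ + 1 / 8) * (τ (idx z' z) * ρ) →
      7 / 8 * (τ (idx y' y) * ρ) ≤ dist u y' → dist u y' ≤ (γ + 1 / 8) * (τ (idx y' y) * ρ) →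
      z' = y' ∧ z = y := by
    intro z' z y' y hz hy u h1 h2 h3 h4
    obtain rfl := hnear u z' hz.1 y' hy.1 (h2.trans_lt (hsmall _)) (h4.trans_lt (hsmall _))
    exact ⟨rfl, (hidx z' hz.1).2 z hz.2.1 hz.2.2.2 y hy.2.1 hy.2.2.2
      (hidx_eq _ _ _ h1 h2 h3 h4)⟩
  -- A reserved point `U z' z` goes to `z`, although it lies near `z'`; any other point goes to the
  -- net point within `ρ / 2` if there is one, and otherwise to some net point within `ρ`. In
  -- particular `U' z' z` goes to `z'`.
  have hp : ∀ u, ∃ q ∈ A, (∀ z' z, Nbr z' z → u = U z' z → q = z) ∧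
      ((∀ z' z, Nbr z' z → u ≠ U z' z) → dist u q ≤ ρ ∧ ∀ w ∈ A, dist u w < ρ / 2 → q = w) := by
    intro u
    by_cases h : ∃ z' z, Nbr z' z ∧ u = U z' z
    · obtain ⟨z', z, hz, rfl⟩ := h
      refine ⟨z, hz.2.1, fun y' y hy h => ?_, fun h => absurd rfl (h z' z hz)⟩
      exact (hinj z' z y' y hz hy _ (hU1 z' z hz) (hU2 z' z hz) (h ▸ hU1 y' y hy)
        (h ▸ hU2 y' y hy)).2
    · push Not at h
      by_cases hw : ∃ w ∈ A, dist u w < ρ / 2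
      · obtain ⟨w, hw, hwu⟩ := hw
        exact ⟨w, hw, fun z' z hz hh => absurd hh (h z' z hz), fun _ =>
          ⟨by linarith, fun w' hw' h' => hnear u w hw w' hw' hwu h'⟩⟩
      · push Not at hw
        obtain ⟨q, hq, hqu⟩ := hA.cover u
        exact ⟨q, hq, fun z' z hz hh => absurd hh (h z' z hz), fun _ =>
          ⟨hqu, fun w' hw' h' => absurd h' (not_lt.2 (hw w' hw'))⟩⟩
  choose p hpA hpU hpn using hp
  refine ⟨p, fun u _ => hpA u, fun u _ => ?_, fun u _ w hw huw => ?_, fun z hz z' hz' hne hzz => ?_⟩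
  · by_cases h : ∃ z' z, Nbr z' z ∧ u = U z' z
    · obtain ⟨z', z, hz, rfl⟩ := h
      refine ⟨z', hz.1, ?_, ?_⟩
      · linarith [hU2 z' z hz, hsmall (idx z' z)]
      · rw [hpU _ z' z hz rfl, dist_comm]
        exact hz.2.2.2
    · push Not at h
      exact ⟨p u, hpA u, (hpn u h).1, by rw [dist_self]; positivity⟩
  · have huw' : dist u w < ρ / 2 := by nlinarith [hτ4 P]
    by_cases h : ∃ z' z, Nbr z' z ∧ u = U z' z
    · obtain ⟨z', z, hz, rfl⟩ := h
      obtain rfl := hnear _ w hw z' hz.1 huw' ((hU2 z' z hz).trans_lt (hsmall _))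
      have h1 := hU1 w z hz
      have h2 : τ P ≤ τ (idx w z) := hτanti _ _ ((hidx w hw).1 z hz.2.1 hz.2.2.2).le
      nlinarith [hτ0 P]
    · push Not at h
      exact (hpn u h).2 w hw huw'
  · have hN : Nbr z' z := ⟨hz', hz, hne, hzz⟩
    refine ⟨U z' z, hUB z' z hN, U' z' z, hUB' z' z hN, hpU _ z' z hN rfl, ?_, hUd z' z hN⟩
    refine (hpn _ fun y' y hy h => ?_).2 z' hz' ((hU2' z' z hN).trans_lt (hsmall _))
    -- `U' z' z` is not itself given away: its distance to `z'` would identify the pair that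
    -- reserved it, and `U ≠ U'` for that pair.
    obtain ⟨rfl, rfl⟩ := hinj z' z y' y hN hy (U' z' z) (hU1' z' z hN) (hU2' z' z hN)
      (h ▸ hU1 y' y hy) (h ▸ hU2 y' y hy)
    exact hUU z' z hN h.symm

/-! ### Levels in a tree, and a pigeonhole principle -/

namespace RefTree

variable {T : Type*} (𝒯 : RefTree T)

theorem mem_periodicPts_of_fixed {w : T} (hw : 𝒯.π w = w) : w ∈ Function.periodicPts 𝒯.π :=
  ⟨1, one_pos, hw⟩

theorem π_φ_of_nonempty (h : (Function.periodicPts 𝒯.π).Nonempty) : 𝒯.π 𝒯.φ = 𝒯.φ := by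
  obtain ⟨n, hn, hφ⟩ := 𝒯.φ_mem h
  exact 𝒯.periodicPts_subsingleton ⟨n, hn, hφ.apply⟩ ⟨n, hn, hφ⟩

theorem eq_φ_of_fixed {w : T} (hw : 𝒯.π w = w) : w = 𝒯.φ :=
  𝒯.periodicPts_subsingleton (𝒯.mem_periodicPts_of_fixed hw)
    (𝒯.φ_mem ⟨w, 𝒯.mem_periodicPts_of_fixed hw⟩)

theorem exists_iterate_eq_φ (h : 𝒯.π 𝒯.φ = 𝒯.φ) (w : T) : ∃ n, 𝒯.π^[n] w = 𝒯.φ := by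
  obtain ⟨n, m, hnm⟩ := 𝒯.exists_common_ancestor w 𝒯.φ
  exact ⟨n, by rw [hnm, Function.iterate_fixed h]⟩

theorem level_φ : 𝒯.level 𝒯.φ = 0 := sub_self _

theorem level_nonneg (h : 𝒯.π 𝒯.φ = 𝒯.φ) (w : T) : 0 ≤ 𝒯.level w := by
  obtain ⟨n, hn⟩ := 𝒯.exists_iterate_eq_φ h w
  have : 𝒯.b 𝒯.φ w = 0 := Nat.sInf_eq_zero.2 (Or.inl ⟨n, hn.symm⟩)
  simp [level, this]

end RefTree

/-- If each candidate failed at some depth, all would fail at the largest of these depths. This is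
the König-type argument that selects a single child, or a single cube, containing a given point. -/
theorem Set.Finite.exists_forall_of_antitone {α : Type*} {F : Set α} (hF : F.Finite)
    {p : α → ℕ → Prop} (hp : ∀ u n, p u (n + 1) → p u n) (h : ∀ n, ∃ u ∈ F, p u n) :
    ∃ u ∈ F, ∀ n, p u n := by
  have hanti : ∀ u n m, n ≤ m → p u m → p u n := fun u n m hnm =>
    Nat.le_induction (fun h => h) (fun k _ ih hk => ih (hp u k hk)) m hnm
  by_contra! hcon
  choose! f hf using hcon
  obtain ⟨M, hM⟩ := (hF.image f).bddAbove
  obtain ⟨u, hu, hpu⟩ := h M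
  exact hf u hu (hanti u _ M (hM ⟨u, hu, rfl⟩) hpu)

/-! ### Cubes over a skeleton of nets -/

/-- A tree together with a center in `X` for every vertex, such that the centers of level `k` are a
net of scale `R * r ^ k` and parents are compatible with the metric as in `exists_parent_map`. -/
structure CubeSkeleton {X T : Type*} [MetricSpace X] (𝒯 : RefTree T) (c : T → X)
    (R r a C : ℝ) : Prop where
  R_pos : 0 < R
  r_pos : 0 < r
  a_pos : 0 < a
  a_le : a ≤ 1 / 8
  three_le : 3 ≤ C
  r_small : 8 * ((C + 1) * r) ≤ a
  level_parent : ∀ w, 𝒯.π w = w ∨ 𝒯.level w = 𝒯.level (𝒯.π w) + 1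
  sep : ∀ w v, 𝒯.level w = 𝒯.level v → w ≠ v → R * r ^ 𝒯.level w ≤ dist (c w) (c v)
  cover : ∀ w x, ∀ n : ℕ, ∃ v, 𝒯.level v = 𝒯.level w + n ∧ dist x (c v) ≤ R * r ^ 𝒯.level v
  exists_near : ∀ u w, 𝒯.π u = w → 𝒯.level u = 𝒯.level w + 1 → ∃ v, 𝒯.level v = 𝒯.level w ∧
    dist (c u) (c v) ≤ R * r ^ 𝒯.level w ∧ dist (c v) (c w) ≤ C * (R * r ^ 𝒯.level w)
  parent_eq : ∀ u w, 𝒯.level u = 𝒯.level w + 1 → dist (c u) (c w) < a * (R * r ^ 𝒯.level w) →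
    𝒯.π u = w
  exists_children : ∀ z z', 𝒯.level z = 𝒯.level z' → z ≠ z' →
    dist (c z) (c z') ≤ C * (R * r ^ 𝒯.level z) → ∃ u u', 𝒯.π u = z ∧ 𝒯.π u' = z' ∧
      𝒯.level u = 𝒯.level z + 1 ∧ 𝒯.level u' = 𝒯.level z + 1 ∧
      dist (c u) (c u') ≤ C * (R * r ^ 𝒯.level u)
  ball_ne_univ : ∀ w, Metric.ball (c w) (R * r ^ 𝒯.level w / 8) ≠ Set.univ

namespace CubeSkeleton

variable {X T : Type*} [MetricSpace X]

/-- The condition on `x` at depth `n` that defines the cube of `w`. -/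
def Reach (𝒯 : RefTree T) (c : T → X) (R r C : ℝ) (x : X) (w : T) (n : ℕ) : Prop :=
  ∃ v, 𝒯.π^[n] v = w ∧ 𝒯.level v = 𝒯.level w + n ∧
    dist x (c v) ≤ 2 * (C + 1) * (R * r ^ 𝒯.level v)

/-- The closed cube of `w`: the points approximated at every depth by centers of descendants. -/
def cube (𝒯 : RefTree T) (c : T → X) (R r C : ℝ) (w : T) : Set X :=
  {x | ∀ n, Reach 𝒯 c R r C x w n}

variable {𝒯 : RefTree T} {c : T → X} {R r a C : ℝ}

theorem r_lt (h : CubeSkeleton 𝒯 c R r a C)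
    : r ≤ 1 / 256 := by
  have := h.a_le
  have := h.three_le
  have := h.r_small
  nlinarith [h.r_pos]

theorem diam_factor_mul_r_le (h : CubeSkeleton 𝒯 c R r a C)
    : 2 * (C + 1) * r ≤ a / 4 := by linarith [h.r_small]

theorem scale_pos (h : CubeSkeleton 𝒯 c R r a C)
    (k : ℤ) : 0 < R * r ^ k := mul_pos h.R_pos (zpow_pos h.r_pos k)

theorem scale_succ (h : CubeSkeleton 𝒯 c R r a C)
    (k : ℤ) : R * r ^ (k + 1) = r * (R * r ^ k) := by
  rw [zpow_add_one₀ h.r_pos.ne']; ring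

theorem tendsto_scale (h : CubeSkeleton 𝒯 c R r a C)
    (k : ℤ) :
    Filter.Tendsto (fun n : ℕ => R * r ^ (k + n)) Filter.atTop (nhds 0) := by
  have h1 := tendsto_pow_atTop_nhds_zero_of_lt_one h.r_pos.le
    (by linarith [h.r_lt] : r < 1)
  have h2 := h1.const_mul (R * r ^ k)
  rw [mul_zero] at h2
  refine h2.congr fun n => ?_
  rw [zpow_add₀ h.r_pos.ne', zpow_natCast]; ring

theorem exists_scale_lt (h : CubeSkeleton 𝒯 c R r a C)
    (k : ℤ) {ε : ℝ} (hε : 0 < ε) : ∃ n : ℕ, R * r ^ (k + n) < ε :=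
  ((h.tendsto_scale k).eventually_lt_const hε).exists

/-- Only the root can be its own parent, and the root has the least level, so a vertex above some
other level is not the root. -/
theorem level_π (h : CubeSkeleton 𝒯 c R r a C)
    {v w : T} (hvw : 𝒯.level w < 𝒯.level v) : 𝒯.level v = 𝒯.level (𝒯.π v) + 1 := by
  refine (h.level_parent v).resolve_left fun hv => ?_
  obtain rfl := 𝒯.eq_φ_of_fixed hv
  linarith [𝒯.level_nonneg hv w, 𝒯.level_φ]

theorem level_iterate (h : CubeSkeleton 𝒯 c R r a C)
    {v w : T} (n : ℕ) (hvw : 𝒯.level w + n ≤ 𝒯.level v) :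
    𝒯.level v = 𝒯.level (𝒯.π^[n] v) + n := by
  induction n with
  | zero => simp
  | succ n ih =>
    push_cast at hvw ⊢
    have h1 := ih (by linarith)
    have h2 := h.level_π (v := 𝒯.π^[n] v) (w := w) (by linarith)
    rw [← Function.iterate_succ_apply' 𝒯.π] at h2
    linarith

theorem dist_parent_le (h : CubeSkeleton 𝒯 c R r a C)
    {u w : T} (huw : 𝒯.π u = w) (hl : 𝒯.level u = 𝒯.level w + 1) :
    dist (c u) (c w) ≤ (C + 1) * (R * r ^ 𝒯.level w) := by
  obtain ⟨v, -, h1, h2⟩ := h.exists_near u w huw hl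
  linarith [dist_triangle (c u) (c v) (c w)]

/-- Moving to the parent costs `(C + 1)` times its scale, while the old error is at most that much
because `2 * r ≤ 1`; hence the factor `2 * (C + 1)` in `Reach` is self-reproducing. -/
theorem reach_of_succ (h : CubeSkeleton 𝒯 c R r a C)
    {x : X} {w : T} {n : ℕ} (hx : Reach 𝒯 c R r C x w (n + 1)) :
    Reach 𝒯 c R r C x w n := by
  obtain ⟨v, hv, hl, hd⟩ := hx
  push_cast at hl
  have hp := h.level_π (v := v) (w := w) (by linarith)
  refine ⟨𝒯.π v, by rwa [← Function.iterate_succ_apply], by linarith, ?_⟩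
  have h1 := h.dist_parent_le rfl hp
  rw [hp, h.scale_succ] at hd
  have h2 := h.scale_pos (𝒯.level (𝒯.π v))
  have h3 := h.r_lt
  have h4 := h.three_le
  have h5 : 2 * (C + 1) * (r * (R * r ^ 𝒯.level (𝒯.π v))) ≤
      (C + 1) * (R * r ^ 𝒯.level (𝒯.π v)) := by
    calc _ = (C + 1) * (2 * r * (R * r ^ 𝒯.level (𝒯.π v))) := by ring
      _ ≤ (C + 1) * (1 * (R * r ^ 𝒯.level (𝒯.π v))) := by gcongr; linarith
      _ = _ := by ring
  linarith [dist_triangle x (c v) (c (𝒯.π v))]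

theorem reach_zero (h : CubeSkeleton 𝒯 c R r a C)
    {x : X} {w : T} {n : ℕ} (hx : Reach 𝒯 c R r C x w n) :
    dist x (c w) ≤ 2 * (C + 1) * (R * r ^ 𝒯.level w) := by
  induction n with
  | zero =>
    obtain ⟨v, hv, -, hd⟩ := hx
    obtain rfl : v = w := hv
    exact hd
  | succ n ih => exact ih (h.reach_of_succ hx)

theorem dist_center_le (h : CubeSkeleton 𝒯 c R r a C)
    {x : X} {w : T} (hx : x ∈ cube 𝒯 c R r C w) :
    dist x (c w) ≤ 2 * (C + 1) * (R * r ^ 𝒯.level w) := h.reach_zero (hx 0)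

theorem cube_subset_π (h : CubeSkeleton 𝒯 c R r a C)
    (v : T) : cube 𝒯 c R r C v ⊆ cube 𝒯 c R r C (𝒯.π v) := by
  rcases h.level_parent v with hv | hv
  · rw [hv]
  · intro x hx n
    refine h.reach_of_succ ?_
    obtain ⟨u, hu, hl, hd⟩ := hx n
    refine ⟨u, by rw [Function.iterate_succ_apply', hu], ?_, hd⟩
    push_cast
    linarith

theorem cube_subset_iterate (h : CubeSkeleton 𝒯 c R r a C)
    (v : T) (n : ℕ) :
    cube 𝒯 c R r C v ⊆ cube 𝒯 c R r C (𝒯.π^[n] v) := by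
  induction n with
  | zero => exact subset_rfl
  | succ n ih =>
    rw [Function.iterate_succ_apply']
    exact ih.trans (h.cube_subset_π _)

theorem finite_near (h : CubeSkeleton 𝒯 c R r a C)
    (hd : DoublingSpace X) (k : ℤ) (x : X) (L : ℝ) :
    {v | 𝒯.level v = k ∧ dist (c v) x ≤ L}.Finite := by
  obtain ⟨P, hP⟩ := hd.exists_packing_bound (L / (R * r ^ k))
  refine Set.finite_of_encard_le_coe (Set.encard_le_of_separated_family
    (hP x (R * r ^ k) (h.scale_pos k)) (h.scale_pos k) c _ ?_ ?_)
  · rintro v ⟨-, hv⟩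
    rwa [div_mul_cancel₀ _ (h.scale_pos k).ne']
  · rintro v ⟨hv, -⟩ w ⟨hw, -⟩ hne
    rw [← hv]
    exact h.sep v w (hv.trans hw.symm) hne

theorem exists_child (h : CubeSkeleton 𝒯 c R r a C)
    (hd : DoublingSpace X) {x : X} {w : T} (hx : x ∈ cube 𝒯 c R r C w) :
    ∃ v, 𝒯.π v = w ∧ 𝒯.level v = 𝒯.level w + 1 ∧ x ∈ cube 𝒯 c R r C v := by
  have hfin : {v | 𝒯.π v = w ∧ 𝒯.level v = 𝒯.level w + 1}.Finite :=
    (h.finite_near hd (𝒯.level w + 1) (c w) ((C + 1) * (R * r ^ 𝒯.level w))).subset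
      fun v hv => ⟨hv.2, h.dist_parent_le hv.1 hv.2⟩
  obtain ⟨v, ⟨hv, hl⟩, hxv⟩ := hfin.exists_forall_of_antitone
    (p := fun v n => Reach 𝒯 c R r C x v n) (fun v n => h.reach_of_succ) (fun n => by
      obtain ⟨u, hu, hl, hxu⟩ := hx (n + 1)
      push_cast at hl
      have h1 := h.level_iterate (v := u) (w := w) n (by linarith)
      refine ⟨𝒯.π^[n] u, ⟨(Function.iterate_succ_apply' 𝒯.π n u).symm.trans hu, by linarith⟩,
        u, rfl, h1, hxu⟩)
  exact ⟨v, hv, hl, hxv⟩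

theorem exists_mem_cube (h : CubeSkeleton 𝒯 c R r a C)
    (hd : DoublingSpace X) (w : T) (x : X) :
    ∃ v, 𝒯.level v = 𝒯.level w ∧ x ∈ cube 𝒯 c R r C v := by
  obtain ⟨v, ⟨hv, -⟩, hxv⟩ := (h.finite_near hd (𝒯.level w) x
      (2 * (C + 1) * (R * r ^ 𝒯.level w))).exists_forall_of_antitone
    (p := fun v n => Reach 𝒯 c R r C x v n) (fun v n => h.reach_of_succ) (fun n => by
      obtain ⟨u, hl, hxu⟩ := h.cover w x n
      have h1 := h.level_iterate (v := u) (w := w) n hl.ge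
      have h2 : Reach 𝒯 c R r C x (𝒯.π^[n] u) n := ⟨u, rfl, h1, hxu.trans (by
        nlinarith [h.scale_pos (𝒯.level u), h.three_le])⟩
      have h3 := h.reach_zero h2
      have h4 : 𝒯.level (𝒯.π^[n] u) = 𝒯.level w := by linarith
      rw [dist_comm, h4] at h3
      exact ⟨𝒯.π^[n] u, ⟨h4, h3⟩, h2⟩)
  exact ⟨v, hv, hxv⟩

/-- The point is within `a / 4` scales of a child `u` of `v`; if `c u` were within `a` scales of `c
w`, then `parent_eq` would make `w` the parent of `u`. -/
theorem dist_center_ge (h : CubeSkeleton 𝒯 c R r a C)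
    {x : X} {v w : T} (hx : x ∈ cube 𝒯 c R r C v)
    (hl : 𝒯.level w = 𝒯.level v) (hne : w ≠ v) :
    a / 2 * (R * r ^ 𝒯.level w) ≤ dist x (c w) := by
  obtain ⟨u, hu, hlu, hxu⟩ := hx 1
  have hu' : 𝒯.π u = v := hu
  have h1 : a * (R * r ^ 𝒯.level w) ≤ dist (c u) (c w) := by
    by_contra! hlt
    exact hne ((h.parent_eq u w (by rw [hlu, hl]; simp) hlt).symm.trans hu')
  rw [hlu, Nat.cast_one, h.scale_succ, ← hl] at hxu
  have h2 := h.scale_pos (𝒯.level w)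
  have h3 := h.diam_factor_mul_r_le
  have h4 : 2 * (C + 1) * (r * (R * r ^ 𝒯.level w)) ≤ a / 4 * (R * r ^ 𝒯.level w) := by
    rw [← mul_assoc]; gcongr
  have h5 := mul_pos h.a_pos h2
  linarith [dist_triangle_left (c u) (c w) x]

theorem ball_subset_cube (h : CubeSkeleton 𝒯 c R r a C)
    (hd : DoublingSpace X) (w : T) :
    Metric.ball (c w) (a / 2 * (R * r ^ 𝒯.level w)) ⊆ cube 𝒯 c R r C w := by
  intro x hx
  obtain ⟨v, hv, hxv⟩ := h.exists_mem_cube hd w x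
  by_cases hwv : w = v
  · rwa [hwv]
  · exact absurd (h.dist_center_ge hxv hv.symm hwv) (not_le.2 hx)

theorem center_mem_cube (h : CubeSkeleton 𝒯 c R r a C)
    (hd : DoublingSpace X) (w : T) : c w ∈ cube 𝒯 c R r C w :=
  h.ball_subset_cube hd w (Metric.mem_ball_self
    (mul_pos (half_pos h.a_pos) (h.scale_pos _)))

theorem cube_subset_closedBall (h : CubeSkeleton 𝒯 c R r a C)
    (w : T) : cube 𝒯 c R r C w ⊆
    Metric.closedBall (c w) (2 * (C + 1) * (R * r ^ 𝒯.level w)) := fun _ hx => h.dist_center_le hx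

theorem isBounded_cube (h : CubeSkeleton 𝒯 c R r a C)
    (w : T) : Bornology.IsBounded (cube 𝒯 c R r C w) :=
  Metric.isBounded_closedBall.subset (h.cube_subset_closedBall w)

theorem diam_le (h : CubeSkeleton 𝒯 c R r a C)
    (w : T) : Metric.diam (cube 𝒯 c R r C w) ≤ 4 * (C + 1) * (R * r ^ 𝒯.level w) := by
  have h1 := h.scale_pos (𝒯.level w)
  have h2 := h.three_le
  have h3 : 0 ≤ 2 * (C + 1) * (R * r ^ 𝒯.level w) := by positivity
  calc _ ≤ 2 * (2 * (C + 1) * (R * r ^ 𝒯.level w)) :=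
        (Metric.diam_mono (h.cube_subset_closedBall w) Metric.isBounded_closedBall).trans
          (Metric.diam_closedBall h3)
    _ = _ := by ring

theorem diam_π_le (h : CubeSkeleton 𝒯 c R r a C)
    (w : T) : Metric.diam (cube 𝒯 c R r C (𝒯.π w)) ≤
    4 * (C + 1) / r * (R * r ^ 𝒯.level w) := by
  have h1 := h.diam_le (𝒯.π w)
  have hr := h.r_pos
  have hC := h.three_le
  have h2 := h.scale_pos (𝒯.level w)
  rcases h.level_parent w with hw | hw
  · rw [hw] at h1 ⊢
    refine h1.trans ?_
    gcongr
    exact le_div_self (by positivity) hr (by linarith [h.r_lt])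
  · rw [hw, h.scale_succ]
    refine h1.trans_eq ?_
    field_simp

theorem isClosed_cube (h : CubeSkeleton 𝒯 c R r a C)
    (hd : DoublingSpace X) (w : T) : IsClosed (cube 𝒯 c R r C w) := by
  have heq : cube 𝒯 c R r C w = ⋂ n : ℕ, ⋃ v ∈ {v | 𝒯.π^[n] v = w ∧ 𝒯.level v = 𝒯.level w + n},
      Metric.closedBall (c v) (2 * (C + 1) * (R * r ^ 𝒯.level v)) := by
    ext x
    simp [cube, Reach, and_assoc]
  rw [heq]
  refine isClosed_iInter fun n => Set.Finite.isClosed_biUnion ?_ fun v _ => Metric.isClosed_closedBall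
  refine (h.finite_near hd (𝒯.level w + n) (c w) (2 * (C + 1) * (R * r ^ 𝒯.level w))).subset ?_
  rintro v ⟨hv, hl⟩
  refine ⟨hl, h.reach_zero (n := n) ⟨v, hv, hl, ?_⟩⟩
  have h1 := h.scale_pos (𝒯.level v)
  have h2 := h.three_le
  rw [dist_self]
  positivity

theorem isCompact_cube (h : CubeSkeleton 𝒯 c R r a C)
    [ProperSpace X] (hd : DoublingSpace X) (w : T) :
    IsCompact (cube 𝒯 c R r C w) :=
  Metric.isCompact_of_isClosed_isBounded (h.isClosed_cube hd w) (h.isBounded_cube w)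

/-- Uniform perfectness is applied at a radius whose `γ`-multiple is that of the ball known to lie
in the cube. -/
theorem exists_far_point (h : CubeSkeleton 𝒯 c R r a C)
    (hd : DoublingSpace X) {γ : ℝ} (hγ : 1 < γ)
    (hu : ∀ (x : X) (r : ℝ), 0 < r → Metric.ball x r ≠ Set.univ →
      (Metric.ball x (γ * r) \ Metric.ball x r).Nonempty) (w : T) :
    ∃ y ∈ cube 𝒯 c R r C w, a / (2 * γ) * (R * r ^ 𝒯.level w) ≤ dist y (c w) := by
  have h1 := h.scale_pos (𝒯.level w)
  have h2 := h.a_pos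
  have h3 := h.a_le
  have h5 : a / (2 * γ) ≤ 1 / 8 := by
    rw [div_le_iff₀ (by positivity)]; linarith
  obtain ⟨y, hy, hy'⟩ := hu (c w) (a / (2 * γ) * (R * r ^ 𝒯.level w)) (by positivity) (by
    intro hc
    refine h.ball_ne_univ w (Set.eq_univ_of_univ_subset (hc.symm.subset.trans
      (Metric.ball_subset_ball ?_)))
    nlinarith)
  have h4 : γ * (a / (2 * γ) * (R * r ^ 𝒯.level w)) = a / 2 * (R * r ^ 𝒯.level w) := by
    field_simp
  rw [h4] at hy
  exact ⟨y, h.ball_subset_cube hd w hy, not_lt.1 hy'⟩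

theorem le_diam (h : CubeSkeleton 𝒯 c R r a C)
    (hd : DoublingSpace X) {γ : ℝ} (hγ : 1 < γ)
    (hu : ∀ (x : X) (r : ℝ), 0 < r → Metric.ball x r ≠ Set.univ →
      (Metric.ball x (γ * r) \ Metric.ball x r).Nonempty) (w : T) :
    a / (2 * γ) * (R * r ^ 𝒯.level w) ≤ Metric.diam (cube 𝒯 c R r C w) := by
  obtain ⟨y, hy, hyw⟩ := h.exists_far_point hd hγ hu w
  exact hyw.trans (Metric.dist_le_diam_of_mem (h.isBounded_cube w) hy (h.center_mem_cube hd w))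

/-- Iterating `exists_children` gives descendants of the two vertices at every depth whose centers
are within `C` scales. The two cubes are therefore at distance zero, and one of them is compact. -/
theorem inter_nonempty (h : CubeSkeleton 𝒯 c R r a C)
    [ProperSpace X] (hd : DoublingSpace X) {z z' : T}
    (hl : 𝒯.level z = 𝒯.level z') (hz : dist (c z) (c z') ≤ C * (R * r ^ 𝒯.level z)) :
    (cube 𝒯 c R r C z ∩ cube 𝒯 c R r C z').Nonempty := by
  rcases eq_or_ne z z' with rfl | hne
  · exact ⟨c z, h.center_mem_cube hd z, h.center_mem_cube hd z⟩
  have key : ∀ n : ℕ, ∃ u u', cube 𝒯 c R r C u ⊆ cube 𝒯 c R r C z ∧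
      cube 𝒯 c R r C u' ⊆ cube 𝒯 c R r C z' ∧ u ≠ u' ∧ 𝒯.level u = 𝒯.level z + n ∧
      𝒯.level u' = 𝒯.level z + n ∧ dist (c u) (c u') ≤ C * (R * r ^ 𝒯.level u) := by
    intro n
    induction n with
    | zero => exact ⟨z, z', subset_rfl, subset_rfl, hne, by simp, by simp [hl], hz⟩
    | succ n ih =>
      obtain ⟨u, u', h1, h2, h3, h4, h5, h6⟩ := ih
      obtain ⟨v, v', g1, g2, g3, g4, g5⟩ := h.exists_children u u' (h4.trans h5.symm) h3 h6
      refine ⟨v, v', (g1 ▸ h.cube_subset_π v).trans h1, (g2 ▸ h.cube_subset_π v').trans h2,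
        fun hv => h3 (by rw [← g1, ← g2, hv]), ?_, ?_, g5⟩ <;> push_cast <;> linarith
  by_contra hemp
  obtain ⟨ε, hε, hdist⟩ := Metric.exists_pos_forall_lt_edist (h.isCompact_cube hd z)
    (h.isClosed_cube hd z') (Set.disjoint_iff_inter_eq_empty.2 (Set.not_nonempty_iff_eq_empty.1 hemp))
  have hC : 0 < C := by linarith [h.three_le]
  obtain ⟨n, hn⟩ := h.exists_scale_lt (𝒯.level z) (ε := ε / C) (div_pos (by exact_mod_cast hε) hC)
  obtain ⟨u, u', h1, h2, -, h4, -, h6⟩ := key n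
  have := hdist _ (h1 (h.center_mem_cube hd u)) _ (h2 (h.center_mem_cube hd u'))
  rw [edist_nndist, ENNReal.coe_lt_coe, ← NNReal.coe_lt_coe, coe_nndist] at this
  rw [h4] at h6
  rw [lt_div_iff₀ hC] at hn
  linarith

end CubeSkeleton

/-! ### Cuts and chain distances for a general family of bounded sets -/

namespace RefTree

variable {T Y : Type*} (𝒯 : RefTree T) [MetricSpace Y] (K : T → Set Y)

theorem diam_le_of_mem_cut {s : ℝ} {w : T} (hw : w ∈ 𝒯.cut K s) : Metric.diam (K w) ≤ s := by
  unfold cut at hw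
  split_ifs at hw with h
  · obtain rfl : w = 𝒯.φ := hw
    exact h.2
  · exact hw.1

/-- A second element rules out the exceptional cut `{φ}`, for which the lower bound can fail. -/
theorem lt_diam_of_mem_cut {s : ℝ} {w v : T} (hw : w ∈ 𝒯.cut K s) (hv : v ∈ 𝒯.cut K s)
    (hne : v ≠ w) : s < Metric.diam (K (𝒯.π w)) := by
  unfold cut at hw hv
  split_ifs at hw hv with h
  · exact absurd ((show v = 𝒯.φ from hv).trans (show w = 𝒯.φ from hw).symm) hne
  · exact hw.2

theorem edist_cutGraph_le_one {s : ℝ} {w v : 𝒯.cut K s} (h : (K w ∩ K v).Nonempty) :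
    (𝒯.cutGraph K s).edist w v ≤ 1 := by
  rcases eq_or_ne w v with rfl | hne
  · simp
  · have hadj : (𝒯.cutGraph K s).Adj w v := ⟨hne, h⟩
    exact (SimpleGraph.edist_eq_one_iff_adj.2 hadj).le

theorem dist_le_of_walk (hK : ∀ w, Bornology.IsBounded (K w)) {s : ℝ} {w v : 𝒯.cut K s}
    (p : (𝒯.cutGraph K s).Walk w v) {x y : Y} (hx : x ∈ K w) (hy : y ∈ K v) :
    dist x y ≤ (p.length + 1) * s := by
  induction p generalizing x with
  | nil =>
    simpa using (Metric.dist_le_diam_of_mem (hK _) hx hy).trans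
      (𝒯.diam_le_of_mem_cut K (Subtype.coe_prop _))
  | cons hadj p ih =>
    obtain ⟨z, hz, hz'⟩ := hadj.2
    have h1 := ih hz' hy
    have h2 := (Metric.dist_le_diam_of_mem (hK _) hx hz).trans
      (𝒯.diam_le_of_mem_cut K (Subtype.coe_prop _))
    rw [SimpleGraph.Walk.length_cons]
    push_cast
    linarith [dist_triangle x z y]

theorem dist_le_of_edist_cutGraph_le (hK : ∀ w, Bornology.IsBounded (K w)) {s : ℝ} (hs : 0 ≤ s)
    {w v : 𝒯.cut K s} {M : ℕ} (h : (𝒯.cutGraph K s).edist w v ≤ M) {x y : Y} (hx : x ∈ K w)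
    (hy : y ∈ K v) : dist x y ≤ (M + 1) * s := by
  have hne : (𝒯.cutGraph K s).edist w v ≠ ⊤ := (h.trans_lt (ENat.natCast_lt_top M)).ne
  obtain ⟨p, hp⟩ := SimpleGraph.exists_walk_of_edist_ne_top hne
  rw [← hp, Nat.cast_le] at h
  refine (𝒯.dist_le_of_walk K hK p hx hy).trans ?_
  gcongr

/-- A chain with `M` edges has `M + 1` sets, each of diameter at most `s`. -/
theorem edist_le_chainDist (hK : ∀ w, Bornology.IsBounded (K w)) (M : ℕ) (x y : Y) :
    edist x y ≤ (M + 1) * 𝒯.chainDist K M x y := by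
  rw [mul_comm, ← ENNReal.div_le_iff_le_mul (by simp) (by simp)]
  refine le_iInf₂ fun s hs => ?_
  obtain ⟨hs, w, v, hx, hy, hwv⟩ := hs
  rw [ENNReal.div_le_iff_le_mul (by simp) (by simp), edist_dist]
  have h1 : ((M : ENNReal) + 1) = ENNReal.ofReal (M + 1) := by
    rw [ENNReal.ofReal_add (by positivity) zero_le_one]; simp
  rw [h1, ← ENNReal.ofReal_mul hs.le, mul_comm s]
  exact ENNReal.ofReal_le_ofReal (𝒯.dist_le_of_edist_cutGraph_le K hK hs.le hwv hx hy)

theorem chainDist_le {s : ℝ} (hs : 0 < s) {M : ℕ} {x y : Y} {w v : 𝒯.cut K s} (hx : x ∈ K w)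
    (hy : y ∈ K v) (h : (𝒯.cutGraph K s).edist w v ≤ M) :
    𝒯.chainDist K M x y ≤ ENNReal.ofReal s :=
  iInf₂_le s ⟨hs, w, v, hx, hy, h⟩

end RefTree

/-! ### The cubes form a partition and satisfy the framework -/

namespace CubeSkeleton

variable {X T : Type*} [MetricSpace X] {𝒯 : RefTree T} {c : T → X} {R r a C : ℝ}

theorem level_iterate_of_unrooted (h : CubeSkeleton 𝒯 c R r a C)
    (h0 : 𝒯.π 𝒯.φ ≠ 𝒯.φ) (w : T) (n : ℕ) :
    𝒯.level (𝒯.π^[n] w) = 𝒯.level w - n := by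
  induction n with
  | zero => simp
  | succ n ih =>
    have := (h.level_parent (𝒯.π^[n] w)).resolve_left
      fun hw => h0 (by rw [𝒯.eq_φ_of_fixed hw] at hw; exact hw)
    rw [Function.iterate_succ_apply']
    push_cast
    linarith

theorem exists_level_eq (h : CubeSkeleton 𝒯 c R r a C)
    (k : ℤ) : (∃ w, 𝒯.level w = k) ∨ (𝒯.π 𝒯.φ = 𝒯.φ ∧ k < 0) := by
  rcases le_or_gt 0 k with hk | hk
  · obtain ⟨v, hv, -⟩ := h.cover 𝒯.φ (c 𝒯.φ) k.toNat
    left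
    refine ⟨v, ?_⟩
    rw [hv, 𝒯.level_φ]
    omega
  · by_cases h0 : 𝒯.π 𝒯.φ = 𝒯.φ
    · exact Or.inr ⟨h0, hk⟩
    · left
      refine ⟨𝒯.π^[(-k).toNat] 𝒯.φ, ?_⟩
      rw [h.level_iterate_of_unrooted h0, 𝒯.level_φ]
      omega

theorem level_branch (h : CubeSkeleton 𝒯 c R r a C)
    {w : ℤ → T} (hw : ∀ k, 𝒯.π (w (k + 1)) = w k) {k : ℤ} (hk : w k ≠ 𝒯.φ)
    (n : ℕ) : 𝒯.level (w (k + n)) = 𝒯.level (w k) + n := by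
  have hit : ∀ n : ℕ, 𝒯.π^[n] (w (k + n)) = w k := by
    intro n
    induction n with
    | zero => simp
    | succ n ih =>
      rw [Function.iterate_succ_apply, Nat.cast_succ, ← add_assoc, hw, ih]
  induction n with
  | zero => simp
  | succ n ih =>
    -- A fixed vertex is `φ` and so are all its iterates, one of which is `w k`.
    have h1 := (h.level_parent (w (k + (n + 1 : ℕ)))).resolve_left fun hfix => hk (by
      rw [← hit (n + 1), Function.iterate_fixed hfix]
      exact 𝒯.eq_φ_of_fixed hfix)
    rw [h1, Nat.cast_succ, ← add_assoc, hw, ih]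
    ring

theorem isPartition (h : CubeSkeleton 𝒯 c R r a C)
    [ProperSpace X] [PerfectSpace X] (hd : DoublingSpace X) {γ : ℝ} (hγ : 1 < γ)
    (hu : ∀ (x : X) (r : ℝ), 0 < r → Metric.ball x r ≠ Set.univ →
      (Metric.ball x (γ * r) \ Metric.ball x r).Nonempty) :
    𝒯.IsPartition (cube 𝒯 c R r C) where
  sigmaCompact := inferInstance
  perfect := inferInstance
  isCompact := h.isCompact_cube hd
  nontrivial w := by
    obtain ⟨y, hy, hyw⟩ := h.exists_far_point hd hγ hu w
    refine ⟨y, hy, c w, h.center_mem_cube hd w, fun he => ?_⟩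
    rw [he, dist_self] at hyw
    have h1 := h.scale_pos (𝒯.level w)
    have h2 := h.a_pos
    have : 0 < a / (2 * γ) * (R * r ^ 𝒯.level w) := by positivity
    linarith
  iUnion_level_zero := by
    refine Set.eq_univ_of_forall fun x => ?_
    obtain ⟨v, hv, hx⟩ := h.exists_mem_cube hd 𝒯.φ x
    exact Set.mem_iUnion₂.2 ⟨v, hv.trans 𝒯.level_φ, hx⟩
  iUnion_children w := by
    refine Set.Subset.antisymm (Set.iUnion₂_subset fun v hv => ?_) fun x hx => ?_
    · have := h.cube_subset_π v
      rwa [hv.1] at this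
    · obtain ⟨v, hv, hl, hxv⟩ := h.exists_child hd hx
      exact Set.mem_iUnion₂.2 ⟨v, ⟨hv, fun he => by rw [he] at hl; omega⟩, hxv⟩
  iInter_branch w hw hne := by
    obtain ⟨k, hk⟩ := hne
    have hanti : Antitone fun k => cube 𝒯 c R r C (w k) := antitone_int_of_succ_le fun k => by
      have := h.cube_subset_π (w (k + 1))
      rwa [hw] at this
    obtain ⟨x, hx⟩ := IsCompact.nonempty_iInter_of_directed_nonempty_isCompact_isClosed
      (fun k => cube 𝒯 c R r C (w k)) hanti.directed_ge (fun k => ⟨_, h.center_mem_cube hd _⟩)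
      (fun k => h.isCompact_cube hd _) (fun k => h.isClosed_cube hd _)
    refine ⟨x, Set.eq_singleton_iff_unique_mem.2 ⟨hx, fun y hy => ?_⟩⟩
    by_contra hxy
    have hC : 0 < 4 * (C + 1) := by linarith [h.three_le]
    obtain ⟨n, hn⟩ := h.exists_scale_lt (𝒯.level (w k)) (div_pos (dist_pos.2 hxy) hC)
    rw [lt_div_iff₀ hC] at hn
    have h1 := Metric.dist_le_diam_of_mem (h.isBounded_cube (w (k + n)))
      (Set.mem_iInter.1 hy _) (Set.mem_iInter.1 hx _)
    have h2 := h.diam_le (w (k + n))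
    rw [h.level_branch hw hk] at h2
    linarith

theorem exists_lt_diam_iterate (h : CubeSkeleton 𝒯 c R r a C) (hd : DoublingSpace X)
    {γ : ℝ} (hγ : 1 < γ)
    (hu : ∀ (x : X) (r : ℝ), 0 < r → Metric.ball x r ≠ Set.univ →
      (Metric.ball x (γ * r) \ Metric.ball x r).Nonempty)
    (h0 : 𝒯.π 𝒯.φ ≠ 𝒯.φ) (w : T) (s : ℝ) :
    ∃ n, s < Metric.diam (cube 𝒯 c R r C (𝒯.π^[n] w)) := by
  have hr := h.r_pos
  have hρ := h.scale_pos (𝒯.level w)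
  have ha := h.a_pos
  have hr1 : 1 < 1 / r := by rw [lt_div_iff₀ hr]; linarith [h.r_lt]
  have hκ : 0 < a / (2 * γ) * (R * r ^ 𝒯.level w) := by positivity
  obtain ⟨n, hn⟩ := pow_unbounded_of_one_lt (s / (a / (2 * γ) * (R * r ^ 𝒯.level w))) hr1
  refine ⟨n, lt_of_lt_of_le ?_ (h.le_diam hd hγ hu _)⟩
  rw [div_lt_iff₀ hκ] at hn
  rw [h.level_iterate_of_unrooted h0, zpow_sub₀ hr.ne', zpow_natCast]
  refine hn.trans_eq ?_
  rw [one_div, inv_pow]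
  ring

/-- The ancestor just before the first one of diameter greater than `s` is in the cut; if no
ancestor is that large, the tree is rooted and the cut is `{φ}`. -/
theorem exists_iterate_mem_cut (h : CubeSkeleton 𝒯 c R r a C) (hd : DoublingSpace X)
    {γ : ℝ} (hγ : 1 < γ)
    (hu : ∀ (x : X) (r : ℝ), 0 < r → Metric.ball x r ≠ Set.univ →
      (Metric.ball x (γ * r) \ Metric.ball x r).Nonempty)
    {w : T} {s : ℝ} (hw : Metric.diam (cube 𝒯 c R r C w) ≤ s) :
    ∃ n, 𝒯.π^[n] w ∈ 𝒯.cut (cube 𝒯 c R r C) s := by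
  classical
  unfold RefTree.cut
  split_ifs with hroot
  · exact 𝒯.exists_iterate_eq_φ (𝒯.π_φ_of_nonempty hroot.1) w
  · have hex : ∃ n, s < Metric.diam (cube 𝒯 c R r C (𝒯.π^[n] w)) := by
      by_cases h0 : 𝒯.π 𝒯.φ = 𝒯.φ
      · obtain ⟨n, hn⟩ := 𝒯.exists_iterate_eq_φ h0 w
        refine ⟨n, ?_⟩
        rw [hn]
        by_contra! hle
        exact hroot ⟨⟨_, 𝒯.mem_periodicPts_of_fixed h0⟩, hle⟩
      · exact h.exists_lt_diam_iterate hd hγ hu h0 w s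
    have hspec := Nat.find_spec hex
    have hpos : Nat.find hex ≠ 0 := fun h0 => by
      rw [h0] at hspec
      exact absurd hw (not_le.2 hspec)
    obtain ⟨n, hn⟩ := Nat.exists_eq_succ_of_ne_zero hpos
    rw [hn, Nat.succ_eq_add_one, Function.iterate_succ_apply'] at hspec
    exact ⟨n, not_lt.1 (Nat.find_min hex (by omega)), hspec⟩

theorem exists_cut_superset (h : CubeSkeleton 𝒯 c R r a C) (hd : DoublingSpace X)
    {γ : ℝ} (hγ : 1 < γ)
    (hu : ∀ (x : X) (r : ℝ), 0 < r → Metric.ball x r ≠ Set.univ →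
      (Metric.ball x (γ * r) \ Metric.ball x r).Nonempty)
    {w : T} {s : ℝ} (hw : Metric.diam (cube 𝒯 c R r C w) ≤ s) :
    ∃ v : 𝒯.cut (cube 𝒯 c R r C) s, cube 𝒯 c R r C w ⊆ cube 𝒯 c R r C v := by
  obtain ⟨n, hn⟩ := h.exists_iterate_mem_cut hd hγ hu hw
  exact ⟨⟨_, hn⟩, h.cube_subset_iterate w n⟩

/-- Say `v` has the smaller level. The ancestor of `v'` at that level is not `v`, since otherwise
the parent of `v'` would lie in a cube of diameter at most `s`. Hence `c v'` is in a different cube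
of the level of `v`, far from `c v` relative to the scale of `v`, and that scale is at least a
multiple of `s` because the parent of `v` has diameter above `s`. -/
theorem cut_separated (h : CubeSkeleton 𝒯 c R r a C) (hd : DoublingSpace X)
    {s : ℝ} {v v' : T} (hv : v ∈ 𝒯.cut (cube 𝒯 c R r C) s)
    (hv' : v' ∈ 𝒯.cut (cube 𝒯 c R r C) s) (hne : v ≠ v') :
    a * r / (8 * (C + 1)) * s ≤ dist (c v) (c v') := by
  wlog hl : 𝒯.level v ≤ 𝒯.level v' generalizing v v'
  · rw [dist_comm]
    exact this hv' hv hne.symm (le_of_not_ge hl)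
  obtain ⟨n, hn⟩ := Int.le.dest hl
  have hlev := h.level_iterate (v := v') (w := v) n hn.le
  have hne' : v ≠ 𝒯.π^[n] v' := by
    intro he
    cases n with
    | zero => exact hne he
    | succ n =>
      have h1 := h.cube_subset_iterate (𝒯.π v') n
      rw [← Function.iterate_succ_apply, ← he] at h1
      linarith [Metric.diam_mono h1 (h.isBounded_cube v), 𝒯.diam_le_of_mem_cut _ hv,
        𝒯.lt_diam_of_mem_cut _ hv' hv hne]
  have h1 := h.dist_center_ge (h.cube_subset_iterate v' n (h.center_mem_cube hd v'))
    (w := v) (by linarith) hne'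
  rw [dist_comm]
  refine le_trans ?_ h1
  have h2 := (𝒯.lt_diam_of_mem_cut _ hv hv' hne.symm).le.trans (h.diam_π_le v)
  have hr := h.r_pos
  have ha := h.a_pos
  have hC := h.three_le
  calc a * r / (8 * (C + 1)) * s
      ≤ a * r / (8 * (C + 1)) * (4 * (C + 1) / r * (R * r ^ 𝒯.level v)) := by gcongr
    _ = a / 2 * (R * r ^ 𝒯.level v) := by field_simp; ring

theorem exists_cut_mem (h : CubeSkeleton 𝒯 c R r a C) (hd : DoublingSpace X)
    {γ : ℝ} (hγ : 1 < γ)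
    (hu : ∀ (x : X) (r : ℝ), 0 < r → Metric.ball x r ≠ Set.univ →
      (Metric.ball x (γ * r) \ Metric.ball x r).Nonempty)
    {s : ℝ} (hs : 0 < s) (x : X) :
    ∃ v : 𝒯.cut (cube 𝒯 c R r C) s, x ∈ cube 𝒯 c R r C v := by
  have hC : 0 < 4 * (C + 1) := by linarith [h.three_le]
  obtain ⟨n, hn⟩ := h.exists_scale_lt (𝒯.level 𝒯.φ) (div_pos hs hC)
  rw [lt_div_iff₀ hC] at hn
  obtain ⟨w, hw, -⟩ := h.cover 𝒯.φ x n
  obtain ⟨v, hv, hxv⟩ := h.exists_mem_cube hd w x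
  have h1 := h.diam_le v
  rw [hv, hw] at h1
  obtain ⟨u, hu⟩ := h.exists_cut_superset hd hγ hu (w := v) (s := s) (by linarith)
  exact ⟨u, hu hxv⟩

/-- Two nearby points are joined by a chain of four cubes of the same level. -/
theorem exists_chain (h : CubeSkeleton 𝒯 c R r a C) (hd : DoublingSpace X)
    [ProperSpace X] (w : T) {x y : X}
    (hxy : dist x y ≤ R * r ^ 𝒯.level w / 2) :
    ∃ z₁ z₂ z₃ z₄, 𝒯.level z₁ = 𝒯.level w ∧ 𝒯.level z₂ = 𝒯.level w ∧ 𝒯.level z₃ = 𝒯.level w ∧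
      𝒯.level z₄ = 𝒯.level w ∧ x ∈ cube 𝒯 c R r C z₁ ∧ y ∈ cube 𝒯 c R r C z₄ ∧
      (cube 𝒯 c R r C z₁ ∩ cube 𝒯 c R r C z₂).Nonempty ∧
      (cube 𝒯 c R r C z₂ ∩ cube 𝒯 c R r C z₃).Nonempty ∧
      (cube 𝒯 c R r C z₃ ∩ cube 𝒯 c R r C z₄).Nonempty := by
  obtain ⟨z₁, hl₁, hx⟩ := h.exists_mem_cube hd w x
  obtain ⟨z₄, hl₄, hy⟩ := h.exists_mem_cube hd w y
  obtain ⟨u, hu, hlu, hxu⟩ := h.exists_child hd hx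
  obtain ⟨u', hu', hlu', hyu'⟩ := h.exists_child hd hy
  -- A parent may be far from its child, so `z₂` and `z₃` are vertices truly near `x` and `y`; each
  -- is still within `C` scales of the cube center it stands in for.
  obtain ⟨z₂, hl₂, h1, h2⟩ := h.exists_near u z₁ hu hlu
  obtain ⟨z₃, hl₃, h3, h4⟩ := h.exists_near u' z₄ hu' hlu'
  have g1 := h.dist_center_le hxu
  have g2 := h.dist_center_le hyu'
  have g3 := h.scale_pos (𝒯.level w)
  rw [hlu, hl₁, h.scale_succ] at g1
  rw [hlu', hl₄, h.scale_succ] at g2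
  rw [hl₁] at h1 h2 hl₂
  rw [hl₄] at h3 h4 hl₃
  refine ⟨z₁, z₂, z₃, z₄, hl₁, hl₂, hl₃, hl₄, hx, hy,
    h.inter_nonempty hd (by rw [hl₁, hl₂]) (by rw [dist_comm, hl₁]; exact h2),
    h.inter_nonempty hd (by rw [hl₂, hl₃]) ?_,
    h.inter_nonempty hd (by rw [hl₃, hl₄]) (by rw [hl₃]; exact h4)⟩
  have g4 : 2 * (C + 1) * (r * (R * r ^ 𝒯.level w)) ≤ 1 / 4 * (R * r ^ 𝒯.level w) := by
    rw [← mul_assoc]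
    gcongr
    linarith [h.diam_factor_mul_r_le, h.a_le]
  -- The distance from `c z₂` to `c z₃` is at most `1 + 1/4 + 1/2 + 1/4 + 1 = 3` scales; this is the
  -- use of `3 ≤ C`.
  have g5 : 3 * (R * r ^ 𝒯.level w) ≤ C * (R * r ^ 𝒯.level w) := by
    gcongr
    exact h.three_le
  rw [hl₂]
  linarith [dist_triangle4 (c z₂) (c u) (c u') (c z₃), dist_triangle4 (c u) x y (c u'),
    dist_comm (c z₂) (c u), dist_comm (c u) x]

theorem chainDist_le_edist (h : CubeSkeleton 𝒯 c R r a C) (hd : DoublingSpace X)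
    {γ : ℝ} (hγ : 1 < γ)
    (hu : ∀ (x : X) (r : ℝ), 0 < r → Metric.ball x r ≠ Set.univ →
      (Metric.ball x (γ * r) \ Metric.ball x r).Nonempty)
    [ProperSpace X] (x y : X) :
    𝒯.chainDist (cube 𝒯 c R r C) 3 x y ≤ ENNReal.ofReal (8 * (C + 1) / r) * edist x y := by
  have hr := h.r_pos
  have hR := h.R_pos
  have hC := h.three_le
  rcases eq_or_ne x y with rfl | hxy
  · rw [edist_self, mul_zero]
    refine le_of_forall_pos_le_add fun ε hε => ?_
    rw [zero_add]
    rcases eq_or_ne ε ⊤ with rfl | hε'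
    · exact le_top
    obtain ⟨v, hv⟩ := h.exists_cut_mem hd hγ hu (ENNReal.toReal_pos hε.ne' hε') x
    rw [← ENNReal.ofReal_toReal hε']
    exact 𝒯.chainDist_le _ (ENNReal.toReal_pos hε.ne' hε') hv hv (by simp)
  have ht := dist_pos.2 hxy
  -- The level `k` is chosen so that `R * r ^ (k + 1) < 2 * dist x y ≤ R * r ^ k`.
  obtain ⟨n, hn1, hn2⟩ := exists_mem_Ioc_zpow (x := 2 * dist x y / R) (y := 1 / r) (by positivity)
    (by rw [lt_div_iff₀ hr]; linarith [h.r_lt])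
  obtain ⟨k, rfl⟩ : ∃ k : ℤ, n = -k - 1 := ⟨-n - 1, by ring⟩
  rw [one_div, inv_zpow', lt_div_iff₀ hR, show -(-k - 1) = k + 1 by ring, mul_comm,
    h.scale_succ] at hn1
  rw [one_div, inv_zpow', div_le_iff₀ hR, show -(-k - 1 + 1) = k by ring, mul_comm _ R] at hn2
  have hρ := h.scale_pos k
  set s := 4 * (C + 1) * (R * r ^ k) with hs
  have hs0 : 0 < s := by positivity
  have hst : s ≤ 8 * (C + 1) / r * dist x y := by
    calc s = 4 * (C + 1) / r * (r * (R * r ^ k)) := by rw [hs]; field_simp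
      _ ≤ 4 * (C + 1) / r * (2 * dist x y) := by gcongr
      _ = _ := by ring
  rw [edist_dist, ← ENNReal.ofReal_mul (by positivity)]
  refine le_trans ?_ (ENNReal.ofReal_le_ofReal hst)
  rcases h.exists_level_eq k with ⟨w, rfl⟩ | ⟨h0, hk⟩
  · obtain ⟨z₁, z₂, z₃, z₄, hl₁, hl₂, hl₃, hl₄, hx, hy, m₁, m₂, m₃⟩ :=
      h.exists_chain hd w (x := x) (y := y) (by linarith)
    have hup : ∀ z, 𝒯.level z = 𝒯.level w →
        ∃ v : 𝒯.cut (cube 𝒯 c R r C) s, cube 𝒯 c R r C z ⊆ cube 𝒯 c R r C v := fun z hz =>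
      h.exists_cut_superset hd hγ hu (by rw [hs, ← hz]; exact h.diam_le z)
    obtain ⟨v₁, hv₁⟩ := hup z₁ hl₁
    obtain ⟨v₂, hv₂⟩ := hup z₂ hl₂
    obtain ⟨v₃, hv₃⟩ := hup z₃ hl₃
    obtain ⟨v₄, hv₄⟩ := hup z₄ hl₄
    refine 𝒯.chainDist_le _ hs0 (hv₁ hx) (hv₄ hy) ?_
    have e₁ := 𝒯.edist_cutGraph_le_one _ (m₁.mono (Set.inter_subset_inter hv₁ hv₂))
    have e₂ := 𝒯.edist_cutGraph_le_one _ (m₂.mono (Set.inter_subset_inter hv₂ hv₃))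
    have e₃ := 𝒯.edist_cutGraph_le_one _ (m₃.mono (Set.inter_subset_inter hv₃ hv₄))
    calc _ ≤ (𝒯.cutGraph (cube 𝒯 c R r C) s).edist v₁ v₂ +
          ((𝒯.cutGraph (cube 𝒯 c R r C) s).edist v₂ v₃ +
            (𝒯.cutGraph (cube 𝒯 c R r C) s).edist v₃ v₄) :=
          SimpleGraph.edist_triangle.trans (add_le_add_right SimpleGraph.edist_triangle _)
      _ ≤ 1 + (1 + 1) := add_le_add e₁ (add_le_add e₂ e₃)
      _ = (3 : ℕ) := by norm_num
  -- The scale is coarser than the root, so the cut is `{φ}` and no chain is needed.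
  · have hφs : Metric.diam (cube 𝒯 c R r C 𝒯.φ) ≤ s := by
      refine (h.diam_le 𝒯.φ).trans ?_
      rw [hs, 𝒯.level_φ]
      gcongr 4 * (C + 1) * (R * ?_)
      exact zpow_le_zpow_right_of_le_one₀ hr (by linarith [h.r_lt]) hk.le
    have hcut : 𝒯.cut (cube 𝒯 c R r C) s = {𝒯.φ} :=
      if_pos ⟨⟨_, 𝒯.mem_periodicPts_of_fixed h0⟩, hφs⟩
    obtain ⟨v, hv⟩ := h.exists_cut_mem hd hγ hu hs0 x
    obtain ⟨v', hv'⟩ := h.exists_cut_mem hd hγ hu hs0 y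
    have hvv : v = v' := Subtype.ext (by
      have h1 : (v : T) ∈ ({𝒯.φ} : Set T) := hcut ▸ v.2
      have h2 : (v' : T) ∈ ({𝒯.φ} : Set T) := hcut ▸ v'.2
      exact h1.trans h2.symm)
    exact 𝒯.chainDist_le _ hs0 hv hv' (by simp [hvv])

theorem basicFramework (h : CubeSkeleton 𝒯 c R r a C) (hd : DoublingSpace X)
    {γ : ℝ} (hγ : 1 < γ)
    (hu : ∀ (x : X) (r : ℝ), 0 < r → Metric.ball x r ≠ Set.univ →
      (Metric.ball x (γ * r) \ Metric.ball x r).Nonempty)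
    [ProperSpace X] : 𝒯.BasicFramework (cube 𝒯 c R r C) where
  children_bounded := by
    obtain ⟨P, hP⟩ := hd.exists_packing_bound ((C + 1) / r)
    -- The extra one accounts for the root, which is a preimage of itself.
    refine ⟨P + 1, fun w => ?_⟩
    have hsub : {v | 𝒯.π v = w} ⊆ insert w {v | 𝒯.π v = w ∧ 𝒯.level v = 𝒯.level w + 1} := by
      rintro v rfl
      rcases h.level_parent v with hv | hv
      · exact Or.inl hv.symm
      · exact Or.inr ⟨rfl, hv⟩
    refine (Set.encard_le_encard hsub).trans ((Set.encard_insert_le _ _).trans ?_)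
    push_cast
    gcongr
    have hρ := h.scale_pos (𝒯.level w + 1)
    refine Set.encard_le_of_separated_family (hP (c w) _ hρ) hρ c _ ?_ ?_
    · rintro v ⟨hv, hl⟩
      refine (h.dist_parent_le hv hl).trans_eq ?_
      rw [h.scale_succ]
      have := h.r_pos
      field_simp
    · rintro v ⟨hv, hl⟩ v' ⟨hv', hl'⟩ hne
      rw [← hl]
      exact h.sep v v' (hl.trans hl'.symm) hne
  minimal w := by
    refine ⟨c w, h.center_mem_cube hd w, fun hmem => ?_⟩
    obtain ⟨v, ⟨hl, hne⟩, hv⟩ := Set.mem_iUnion₂.1 hmem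
    have h1 := h.dist_center_ge hv hl.symm hne.symm
    rw [dist_self] at h1
    exact absurd h1 (not_le.2 (mul_pos (half_pos h.a_pos) (h.scale_pos _)))
  locallyFinite w := by
    have hρ := h.scale_pos (𝒯.level w)
    have hC := h.three_le
    refine ⟨Metric.ball (c w) (4 * (C + 1) * (R * r ^ 𝒯.level w)), Metric.isOpen_ball, ?_, ?_⟩
    · refine (h.cube_subset_closedBall w).trans (Metric.closedBall_subset_ball ?_)
      nlinarith
    · refine (h.finite_near hd (𝒯.level w) (c w) (6 * (C + 1) * (R * r ^ 𝒯.level w))).subset ?_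
      rintro v ⟨hl, x, hx, hxv⟩
      refine ⟨hl, ?_⟩
      have h1 := h.dist_center_le hxv
      rw [hl] at h1
      rw [Metric.mem_ball] at hx
      linarith [dist_triangle_left (c v) (c w) x]
  adapted := by
    have hr := h.r_pos
    have hC := h.three_le
    have hE : 0 < 8 * (C + 1) / r := by positivity
    refine ⟨3, 8 * (C + 1) / r, by norm_num, hE, fun x y => ⟨?_, ?_⟩⟩
    · calc _ ≤ ENNReal.ofReal (8 * (C + 1) / r)⁻¹ *
            (ENNReal.ofReal (8 * (C + 1) / r) * edist x y) := by
            gcongr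
            exact h.chainDist_le_edist hd hγ hu x y
        _ = edist x y := by
          rw [← mul_assoc, ← ENNReal.ofReal_mul (by positivity), inv_mul_cancel₀ hE.ne']
          simp
    · refine (𝒯.edist_le_chainDist _ h.isBounded_cube 3 x y).trans ?_
      gcongr
      rw [← ENNReal.ofReal_natCast, ← ENNReal.ofReal_one,
        ← ENNReal.ofReal_add (by positivity) zero_le_one]
      refine ENNReal.ofReal_le_ofReal ?_
      rw [le_div_iff₀ hr]
      have := h.r_lt
      push_cast
      linarith
  thick := by
    have hr := h.r_pos
    have hC := h.three_le
    have ha := h.a_pos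
    refine ⟨a * r / (32 * (C + 1)), by positivity, fun w => ⟨c w, h.center_mem_cube hd w, ?_⟩⟩
    intro y hy
    refine h.ball_subset_cube hd w ?_
    have hρ := h.scale_pos (𝒯.level w)
    have h1 : edist (c w) y ≤ ENNReal.ofReal
        (2 * (a * r / (32 * (C + 1)) * Metric.diam (cube 𝒯 c R r C (𝒯.π w)))) := by
      refine (𝒯.edist_le_chainDist _ h.isBounded_cube 1 (c w) y).trans ?_
      rw [ENNReal.ofReal_mul zero_le_two]
      refine mul_le_mul' ?_ hy
      rw [Nat.cast_one, one_add_one_eq_two, ENNReal.ofReal_ofNat]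
    rw [edist_dist, ENNReal.ofReal_le_ofReal_iff (by positivity)] at h1
    rw [Metric.mem_ball, dist_comm]
    calc dist (c w) y
        ≤ 2 * (a * r / (32 * (C + 1)) * Metric.diam (cube 𝒯 c R r C (𝒯.π w))) := h1
      _ ≤ 2 * (a * r / (32 * (C + 1)) * (4 * (C + 1) / r * (R * r ^ 𝒯.level w))) := by
          gcongr
          exact h.diam_π_le w
      _ = a / 4 * (R * r ^ 𝒯.level w) := by field_simp; ring
      _ < a / 2 * (R * r ^ 𝒯.level w) := by gcongr; linarith
  uniformlyFinite := by
    have hr := h.r_pos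
    have hC := h.three_le
    have ha := h.a_pos
    obtain ⟨P, hP⟩ := hd.exists_packing_bound (2 / (a * r / (8 * (C + 1))))
    refine ⟨P, fun s hs w => ?_⟩
    have hpos : 0 < a * r / (8 * (C + 1)) * s := by positivity
    refine Set.encard_le_of_separated_family (hP (c w) _ hpos) hpos
      (fun v : 𝒯.cut (cube 𝒯 c R r C) s => c v) _ ?_ ?_
    · intro v hv
      have h1 := 𝒯.dist_le_of_edist_cutGraph_le _ h.isBounded_cube hs.le (M := 1)
        (by simpa using hv) (h.center_mem_cube hd w) (h.center_mem_cube hd v)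
      rw [dist_comm]
      refine h1.trans_eq ?_
      field_simp
      norm_num
    · intro v _ v' _ hne
      exact h.cut_separated hd v.2 v'.2 fun he => hne (Subtype.ext he)
  diam_comparable := by
    have hr := h.r_pos
    have hR := h.R_pos
    have hC := h.three_le
    have ha := h.a_pos
    refine ⟨max (4 * (C + 1) * R) (a / (2 * γ) * R)⁻¹, r, lt_max_of_lt_left (by positivity), hr,
      by linarith [h.r_lt], fun w => ⟨?_, ?_⟩⟩
    · refine le_trans ?_ (h.le_diam hd hγ hu w)
      rw [← mul_assoc]
      gcongr
      exact inv_le_of_inv_le₀ (by positivity) (le_max_right _ _)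
    · refine (h.diam_le w).trans ?_
      rw [← mul_assoc]
      gcongr
      exact le_max_left _ _

end CubeSkeleton

/-! ### Building the tree and the skeleton from nets -/

/-- The points of countably many countable sets, labelled by their levels, as a type in `Type`. -/
theorem exists_nodes {X : Type*} (A : ℤ → Set X) (hA : ∀ k, (A k).Countable) (Q : ℤ → Prop) :
    ∃ (T : Type) (lev : T → ℤ) (c : T → X), Countable T ∧
      (∀ t t', lev t = lev t' → c t = c t' → t = t') ∧ (∀ t, Q (lev t)) ∧
      (∀ t, c t ∈ A (lev t)) ∧ ∀ k, Q k → ∀ z ∈ A k, ∃ t, lev t = k ∧ c t = z := by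
  have hS : Set.Countable {q : ℤ × X | Q q.1 ∧ q.2 ∈ A q.1} := by
    refine (Set.countable_iUnion fun k : ℤ => (hA k).image (Prod.mk k)).mono ?_
    rintro ⟨k, z⟩ ⟨-, hz⟩
    exact Set.mem_iUnion.2 ⟨k, z, hz, rfl⟩
  have : Countable {q : ℤ × X | Q q.1 ∧ q.2 ∈ A q.1} := hS
  let e := equivShrink.{0} {q : ℤ × X | Q q.1 ∧ q.2 ∈ A q.1}
  refine ⟨Shrink.{0} {q : ℤ × X | Q q.1 ∧ q.2 ∈ A q.1}, fun t => (e.symm t).1.1,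
    fun t => (e.symm t).1.2, e.symm.countable_iff.2 this, ?_, fun t => (e.symm t).2.1,
    fun t => (e.symm t).2.2, fun k hk z hz => ⟨e ⟨(k, z), hk, hz⟩, by simp, by simp⟩⟩
  intro t t' h1 h2
  exact e.symm.injective (Subtype.ext (Prod.ext h1 h2))

theorem level_iterate_eq {T : Type*} {π : T → T} {lev : T → ℤ} (hπ : ∀ t, lev t = lev (π t) + 1)
    (n : ℕ) (t : T) : lev t = lev (π^[n] t) + n := by
  induction n with
  | zero => simp
  | succ n ih =>
    have := hπ (π^[n] t)
    rw [Function.iterate_succ_apply']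
    push_cast
    linarith

/-- Each step lowers `lev` by one, so there are no periodic points, and when iterates of `t` and `φ`
meet, the difference of the step counts is `lev t`; the two minima in `b` are thus attained
together. -/
theorem exists_refTree_of_unrooted {T : Type*} [Countable T] (π : T → T) (lev : T → ℤ) (φ : T)
    (hφ : lev φ = 0) (hπ : ∀ t, lev t = lev (π t) + 1)
    (hanc : ∀ w v : T, ∃ n m : ℕ, π^[n] w = π^[m] v) :
    ∃ 𝒯 : RefTree T, 𝒯.π = π ∧ 𝒯.φ = φ ∧ ∀ t, 𝒯.level t = lev t := by
  have hper : Function.periodicPts π = ∅ := by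
    refine Set.eq_empty_of_forall_notMem ?_
    rintro t ⟨n, hn, ht⟩
    have := level_iterate_eq hπ n t
    rw [ht.eq] at this
    omega
  refine ⟨⟨π, φ, inferInstance, by simp [hper], hanc, by simp [hper]⟩, rfl, rfl, fun t => ?_⟩
  obtain ⟨n₀, m₀, h0⟩ := hanc t φ
  obtain ⟨m, hm⟩ := Nat.sInf_mem (s := {n : ℕ | ∃ m : ℕ, π^[n] t = π^[m] φ}) ⟨n₀, m₀, h0⟩
  obtain ⟨n, hn⟩ := Nat.sInf_mem (s := {n : ℕ | ∃ m : ℕ, π^[n] φ = π^[m] t}) ⟨m₀, n₀, h0.symm⟩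
  have h1 : sInf {n : ℕ | ∃ m : ℕ, π^[n] t = π^[m] φ} ≤ n := Nat.sInf_le ⟨_, hn.symm⟩
  have h2 : sInf {n : ℕ | ∃ m : ℕ, π^[n] φ = π^[m] t} ≤ m := Nat.sInf_le ⟨_, hm.symm⟩
  have h3 := level_iterate_eq hπ (sInf {n : ℕ | ∃ m : ℕ, π^[n] t = π^[m] φ}) t
  have h4 := level_iterate_eq hπ (sInf {n : ℕ | ∃ m : ℕ, π^[n] φ = π^[m] t}) φ
  have h5 := level_iterate_eq hπ n t
  have h6 := level_iterate_eq hπ m φ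
  rw [hm] at h3
  rw [hn] at h4
  simp only [RefTree.level, RefTree.b]
  omega

/-- Iterates of `φ` stay at `φ`, so `b φ t = 0`, and `b t φ` counts the steps to the root, which is
`lev t`. -/
theorem exists_refTree_of_rooted {T : Type*} [Countable T] (π : T → T) (lev : T → ℤ) (φ : T)
    (hφ : lev φ = 0) (hπφ : π φ = φ) (hπ : ∀ t, t ≠ φ → lev t = lev (π t) + 1)
    (hlev : ∀ t, 0 ≤ lev t) (hroot : ∀ t, lev t = 0 → t = φ) :
    ∃ 𝒯 : RefTree T, 𝒯.π = π ∧ 𝒯.φ = φ ∧ ∀ t, 𝒯.level t = lev t := by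
  have hit : ∀ (n : ℕ) (t : T), lev (π^[n] t) = max (lev t - n) 0 := by
    intro n
    induction n with
    | zero => intro t; simpa using hlev t
    | succ n ih =>
      intro t
      rw [Function.iterate_succ_apply, ih]
      by_cases ht : t = φ
      · subst ht
        rw [hπφ, hφ]
        push_cast
        omega
      · have := hπ t ht
        push_cast
        omega
  have hitφ : ∀ (n : ℕ) (t : T), π^[n] t = φ ↔ lev t ≤ n := by
    intro n t
    have h1 := hit n t
    constructor
    · intro h
      rw [h, hφ] at h1
      omega
    · intro h
      refine hroot _ ?_
      omega
  have hper : Function.periodicPts π ⊆ {φ} := by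
    rintro t ⟨n, hn, ht⟩
    have h1 := hit n t
    rw [ht.eq] at h1
    exact hroot t (by have := hlev t; omega)
  refine ⟨⟨π, φ, inferInstance, Set.subsingleton_singleton.anti hper, fun w v =>
    ⟨(lev w).toNat, (lev v).toNat, ?_⟩, fun _ => ⟨1, one_pos, hπφ⟩⟩, rfl, rfl, fun t => ?_⟩
  · rw [(hitφ _ w).2 (by omega), (hitφ _ v).2 (by omega)]
  · have h1 : sInf {n : ℕ | ∃ m : ℕ, π^[n] φ = π^[m] t} = 0 :=
      Nat.sInf_eq_zero.2 (Or.inl ⟨(lev t).toNat, ((hitφ _ t).2 (by omega)).symm⟩)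
    have h2 : {n : ℕ | ∃ m : ℕ, π^[n] t = π^[m] φ} = Set.Ici (lev t).toNat := by
      ext n
      have hlt := hlev t
      simp only [Set.mem_ofPred_eq, Function.iterate_fixed hπφ, hitφ, exists_const, Set.mem_Ici]
      omega
    simp only [RefTree.level, RefTree.b, h1, h2, csInf_Ici]
    have := hlev t
    omega

/-- A node eventually descends from the nodes with a fixed center, if such nodes exist on all
levels. -/
theorem eventually_iterate_eq {X T : Type*} [MetricSpace X] {π : T → T} {lev : T → ℤ} {c : T → X}
    {r a C : ℝ} (hr : 0 < r) (ha : 0 < a) (ha1 : a ≤ 1 / 8) (hC : 3 ≤ C)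
    (hra : 8 * ((C + 1) * r) ≤ a) (hπ : ∀ t, lev t = lev (π t) + 1)
    (hdist : ∀ t, dist (c t) (c (π t)) ≤ (C + 1) * r ^ lev (π t))
    (heq : ∀ u w, lev u = lev w + 1 → dist (c u) (c w) < a * r ^ lev w → π u = w)
    {x₀ : X} {o : ℤ → T} (ho : ∀ k, lev (o k) = k) (hoc : ∀ k, c (o k) = x₀) (w : T) :
    ∃ n₀ : ℕ, ∀ n, n₀ ≤ n → π^[n] w = o (lev w - n) := by
  have hr1 : r ≤ 1 / 256 := by nlinarith
  -- A geometric sum dominated by its last term: all ancestors stay within a bounded number of their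
  -- own scales from `c w`.
  have hsum : ∀ n : ℕ, dist (c w) (c (π^[n] w)) ≤ 2 * (C + 1) * r ^ lev (π^[n] w) := by
    intro n
    induction n with
    | zero =>
      have : 0 < r ^ lev w := zpow_pos hr _
      simp only [Function.iterate_zero, id_eq, dist_self]
      positivity
    | succ n ih =>
      rw [Function.iterate_succ_apply']
      have h1 := hdist (π^[n] w)
      rw [hπ (π^[n] w), zpow_add_one₀ hr.ne'] at ih
      have h2 : 0 < r ^ lev (π (π^[n] w)) := zpow_pos hr _
      have h3 : 2 * (C + 1) * (r ^ lev (π (π^[n] w)) * r) ≤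
          (C + 1) * r ^ lev (π (π^[n] w)) := by
        calc _ = (C + 1) * r ^ lev (π (π^[n] w)) * (2 * r) := by ring
          _ ≤ (C + 1) * r ^ lev (π (π^[n] w)) * 1 := by gcongr; linarith
          _ = _ := mul_one _
      linarith [dist_triangle (c w) (c (π^[n] w)) (c (π (π^[n] w)))]
  have hr2 : 1 < 1 / r := by rw [lt_div_iff₀ hr]; linarith
  have hpos : 0 < a / 2 * r ^ lev w := mul_pos (half_pos ha) (zpow_pos hr _)
  obtain ⟨n₀, hn₀⟩ := pow_unbounded_of_one_lt (dist (c w) x₀ / (a / 2 * r ^ lev w)) hr2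
  -- One extra step: it is the child `π^[m] w`, once close to `x₀` relative to the next scale, whose
  -- parent is forced to be `o`.
  refine ⟨n₀ + 1, fun n hn => ?_⟩
  obtain ⟨m, rfl⟩ : ∃ m, n = m + 1 := ⟨n - 1, by omega⟩
  have hlm := level_iterate_eq hπ m w
  rw [Function.iterate_succ_apply']
  refine heq _ _ (by rw [ho]; push_cast; omega) ?_
  rw [hoc, ho]
  have h1 := hsum m
  have h2 : r ^ lev (π^[m] w) = r ^ (lev w - (m + 1 : ℕ)) * r := by
    rw [← zpow_add_one₀ hr.ne']
    congr 1
    push_cast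
    omega
  have h3 : 0 < r ^ (lev w - (m + 1 : ℕ)) := zpow_pos hr _
  have h4 : 2 * (C + 1) * (r ^ (lev w - (m + 1 : ℕ)) * r) ≤
      a / 4 * r ^ (lev w - (m + 1 : ℕ)) := by
    calc _ = (2 * (C + 1) * r) * r ^ (lev w - (m + 1 : ℕ)) := by ring
      _ ≤ _ := by gcongr; linarith
  have h5 : dist (c w) x₀ < a / 2 * r ^ (lev w - (m + 1 : ℕ)) := by
    rw [div_lt_iff₀ hpos] at hn₀
    have h6 : (1 / r) ^ n₀ ≤ (1 / r) ^ (m + 1) := pow_le_pow_right₀ hr2.le (by omega)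
    calc dist (c w) x₀ < (1 / r) ^ n₀ * (a / 2 * r ^ lev w) := hn₀
      _ ≤ (1 / r) ^ (m + 1) * (a / 2 * r ^ lev w) := by gcongr
      _ = _ := by
        rw [zpow_sub₀ hr.ne', zpow_natCast, one_div, inv_pow]
        ring
  rw [h2] at h1
  have h7 := mul_pos ha h3
  linarith [dist_triangle_left (c (π^[m] w)) x₀ (c w)]

theorem CubeSkeleton.of_nets {X T : Type*} [MetricSpace X] {𝒯 : RefTree T} {lev : T → ℤ}
    {c : T → X} {R r a C : ℝ} (hR : 0 < R) (hr : 0 < r) (ha : 0 < a) (ha1 : a ≤ 1 / 8)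
    (hC : 3 ≤ C) (hra : 8 * ((C + 1) * r) ≤ a) {Q : ℤ → Prop} (hQ : ∀ k, Q k → Q (k + 1))
    {A : ℤ → Set X} (hA : ∀ k, IsNet (A k) (R * r ^ k)) {p : ℤ → X → X}
    (hnear : ∀ k, ∀ u ∈ A (k + 1), ∃ w ∈ A k, dist u w ≤ R * r ^ k ∧
      dist w (p k u) ≤ C * (R * r ^ k))
    (heq : ∀ k, ∀ u ∈ A (k + 1), ∀ w ∈ A k, dist u w < a * (R * r ^ k) → p k u = w)
    (hchild : ∀ k, ∀ z ∈ A k, ∀ z' ∈ A k, z ≠ z' → dist z z' ≤ C * (R * r ^ k) →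
      ∃ u ∈ A (k + 1), ∃ u' ∈ A (k + 1), p k u = z ∧ p k u' = z' ∧
        dist u u' ≤ C * (R * r ^ (k + 1)))
    (hinj : ∀ t t', lev t = lev t' → c t = c t' → t = t') (hQl : ∀ t, Q (lev t))
    (hcA : ∀ t, c t ∈ A (lev t)) (hex : ∀ k, Q k → ∀ z ∈ A k, ∃ t, lev t = k ∧ c t = z)
    (hπ : ∀ t, 𝒯.π t = t ∨ (lev t = lev (𝒯.π t) + 1 ∧ c (𝒯.π t) = p (lev (𝒯.π t)) (c t)))
    (hlev : ∀ t, 𝒯.level t = lev t)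
    (hball : ∀ t, Metric.ball (c t) (R * r ^ lev t / 8) ≠ Set.univ) :
    CubeSkeleton 𝒯 c R r a C := by
  have hcπ : ∀ u w, lev u = lev w + 1 →
      lev (𝒯.π u) = lev w ∧ c (𝒯.π u) = p (lev w) (c u) := by
    intro u w hl
    rcases hπ u with hu | ⟨h1, h2⟩
    · obtain rfl := 𝒯.eq_φ_of_fixed hu
      have h1 := 𝒯.level_nonneg hu w
      have h2 := 𝒯.level_φ
      rw [hlev] at h1 h2
      omega
    · have h3 : lev (𝒯.π u) = lev w := by omega
      exact ⟨h3, by rw [h2, h3]⟩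
  have hex' : ∀ w, ∀ u ∈ A (lev w + 1), ∃ t, lev t = lev w + 1 ∧ c t = u := fun w u hu =>
    hex _ (hQ _ (hQl w)) u hu
  have hcA' : ∀ u w, lev u = lev w + 1 → c u ∈ A (lev w + 1) := fun u w hl => hl ▸ hcA u
  have hQn : ∀ t, ∀ n : ℕ, Q (lev t + n) := by
    intro t n
    induction n with
    | zero => simpa using hQl t
    | succ n ih => simpa [add_assoc] using hQ _ ih
  refine ⟨hR, hr, ha, ha1, hC, hra, ?_, ?_, ?_, ?_, ?_, ?_, ?_⟩ <;> simp only [hlev]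
  · exact fun w => (hπ w).imp_right And.left
  · intro w v hl hne
    exact (hA _).sep _ (hcA w) _ (hl ▸ hcA v) fun hc => hne (hinj w v hl hc)
  · intro w x n
    obtain ⟨z, hz, hxz⟩ := (hA (lev w + n)).cover x
    obtain ⟨t, ht, rfl⟩ := hex _ (hQn w n) z hz
    exact ⟨t, ht, by rwa [ht]⟩
  · rintro u w hu hl
    obtain ⟨z, hz, h1, h2⟩ := hnear (lev w) (c u) (hcA' u w hl)
    obtain ⟨t, ht, rfl⟩ := hex _ (hQl w) z hz
    have h3 := (hcπ u w hl).2
    rw [hu] at h3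
    exact ⟨t, ht, h1, by rwa [h3]⟩
  · intro u w hl hd
    obtain ⟨h1, h2⟩ := hcπ u w hl
    exact hinj _ _ h1 (h2.trans (heq _ _ (hcA' u w hl) _ (hcA w) hd))
  · intro z z' hl hne hd
    obtain ⟨u, hu, u', hu', h1, h2, h3⟩ := hchild (lev z) (c z) (hcA z) (c z') (hl ▸ hcA z')
      (fun hc => hne (hinj _ _ hl hc)) hd
    obtain ⟨t, ht, rfl⟩ := hex' z u hu
    obtain ⟨t', ht', rfl⟩ := hex' z u' hu'
    obtain ⟨g1, g2⟩ := hcπ t z ht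
    obtain ⟨g1', g2'⟩ := hcπ t' z ht'
    exact ⟨t, t', hinj _ _ g1 (g2.trans h1), hinj _ _ (g1'.trans hl) (g2'.trans h2), ht, ht',
      by rwa [ht]⟩
  · exact hball

theorem exists_cubeSkeleton {X : Type*} [MetricSpace X] [Nontrivial X]
    [TopologicalSpace.SeparableSpace X] (hd : DoublingSpace X) {γ : ℝ} (hγ : 1 < γ)
    (hu : ∀ (x : X) (r : ℝ), 0 < r → Metric.ball x r ≠ Set.univ →
      (Metric.ball x (γ * r) \ Metric.ball x r).Nonempty) :
    ∃ (T : Type) (𝒯 : RefTree T) (c : T → X) (R r a C : ℝ), CubeSkeleton 𝒯 c R r a C := by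
  obtain ⟨a, ha, ha1, hpar⟩ := exists_parent_map hγ hu hd
  have hC : 3 ≤ 3 * γ := by linarith
  obtain ⟨r, hr, hra⟩ : ∃ r : ℝ, 0 < r ∧ 8 * ((3 * γ + 1) * r) ≤ a :=
    ⟨a / (8 * (3 * γ + 1)), by positivity, le_of_eq (by field_simp)⟩
  have hr1 : r ≤ 1 := by nlinarith
  obtain ⟨x₀⟩ : Nonempty X := inferInstance
  have hdata : ∀ R : ℝ, 0 < R → ∃ (A : ℤ → Set X) (p : ℤ → X → X), (∀ k, x₀ ∈ A k) ∧
      (∀ k, IsNet (A k) (R * r ^ k)) ∧ (∀ k, ∀ u ∈ A (k + 1), p k u ∈ A k) ∧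
      (∀ k, ∀ u ∈ A (k + 1), ∃ w ∈ A k, dist u w ≤ R * r ^ k ∧
        dist w (p k u) ≤ 3 * γ * (R * r ^ k)) ∧
      (∀ k, ∀ u ∈ A (k + 1), ∀ w ∈ A k, dist u w < a * (R * r ^ k) → p k u = w) ∧
      (∀ k, ∀ z ∈ A k, ∀ z' ∈ A k, z ≠ z' → dist z z' ≤ 3 * γ * (R * r ^ k) →
        ∃ u ∈ A (k + 1), ∃ u' ∈ A (k + 1), p k u = z ∧ p k u' = z' ∧
          dist u u' ≤ 3 * γ * (R * r ^ (k + 1))) := by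
    intro R hR
    have hρ : ∀ k : ℤ, 0 < R * r ^ k := fun k => mul_pos hR (zpow_pos hr k)
    have hsucc : ∀ k : ℤ, R * r ^ (k + 1) = r * (R * r ^ k) := fun k => by
      rw [zpow_add_one₀ hr.ne']; ring
    choose A hxA hA using fun k : ℤ => exists_isNet x₀ (hρ k)
    choose p hp1 hp2 hp3 hp4 using fun k : ℤ => hpar r (R * r ^ k) hr hra (hρ k) (A k) (A (k + 1))
      (hA k) (hsucc k ▸ hA (k + 1))
    exact ⟨A, p, hxA, hA, hp1, hp2, hp3, fun k => by rw [hsucc]; exact hp4 k⟩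
  by_cases hb : Bornology.IsBounded (Set.univ : Set X)
  · obtain ⟨x, y, hxy⟩ := exists_pair_ne X
    have hdiam : ∀ x y : X, dist x y ≤ Metric.diam (Set.univ : Set X) := fun x y =>
      Metric.dist_le_diam_of_mem hb trivial trivial
    have hD : 0 < Metric.diam (Set.univ : Set X) := (dist_pos.2 hxy).trans_le (hdiam x y)
    -- With `R` twice the diameter, points of `A 0` would be too far apart to be distinct, so level
    -- zero is the root alone; `R / 8` is still small enough for `ball_ne_univ`.
    obtain ⟨A, p, hxA, hA, hp1, hp2, hp3, hp4⟩ := hdata (2 * Metric.diam (Set.univ : Set X))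
      (by positivity)
    obtain ⟨T, lev, c, hT, hinj, hQ, hcA, hex⟩ := exists_nodes A
      (fun k => (hA k).countable (by positivity)) (fun k => 0 ≤ k)
    obtain ⟨φ, hφ, hφx⟩ := hex 0 le_rfl x₀ (hxA 0)
    have hroot : ∀ t, lev t = 0 → t = φ := by
      intro t ht
      refine hinj t φ (ht.trans hφ.symm) ?_
      by_contra hne
      have h1 := (hA 0).sep _ (ht ▸ hcA t) _ (hφ ▸ hcA φ) hne
      rw [zpow_zero] at h1
      linarith [hdiam (c t) (c φ)]
    have hparent : ∀ t, ∃ t', (t = φ → t' = φ) ∧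
        (t ≠ φ → lev t = lev t' + 1 ∧ c t' = p (lev t') (c t)) := by
      intro t
      by_cases ht : t = φ
      · exact ⟨φ, fun _ => rfl, fun h => absurd ht h⟩
      · have h0 : lev t ≠ 0 := fun h => ht (hroot t h)
        have h1 := hQ t
        obtain ⟨t', h2, h3⟩ := hex (lev t - 1) (by omega) (p (lev t - 1) (c t))
          (hp1 _ _ (by simpa using hcA t))
        exact ⟨t', fun h => absurd h ht, fun _ => ⟨by omega, by rw [h2, h3]⟩⟩
    choose π hπ1 hπ2 using hparent
    obtain ⟨𝒯, h𝒯π, h𝒯φ, hlev⟩ := exists_refTree_of_rooted π lev φ hφ (hπ1 φ rfl)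
      (fun t ht => (hπ2 t ht).1) hQ hroot
    refine ⟨T, 𝒯, c, _, r, a, 3 * γ, CubeSkeleton.of_nets (R := 2 * Metric.diam (Set.univ : Set X))
      (by positivity) hr ha ha1 hC hra (Q := fun k => 0 ≤ k) (fun k hk => by omega) hA hp2 hp3 hp4
      hinj hQ hcA hex ?_ hlev ?_⟩
    · intro t
      rw [h𝒯π]
      by_cases ht : t = φ
      · exact Or.inl (by rw [hπ1 t ht, ht])
      · exact Or.inr (hπ2 t ht)
    · intro t hball
      have h1 : r ^ lev t ≤ 1 := by
        obtain ⟨n, hn⟩ := Int.eq_ofNat_of_zero_le (hQ t)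
        rw [hn, zpow_natCast]
        exact pow_le_one₀ hr.le hr1
      have h2 : Metric.diam (Set.univ : Set X) ≤
          2 * (2 * Metric.diam (Set.univ : Set X) * r ^ lev t / 8) := by
        nth_rewrite 1 [← hball]
        exact Metric.diam_ball (by positivity)
      nlinarith
  · obtain ⟨A, p, hxA, hA, hp1, hp2, hp3, hp4⟩ := hdata 1 one_pos
    obtain ⟨T, lev, c, hT, hinj, hQ, hcA, hex⟩ := exists_nodes A
      (fun k => (hA k).countable (by positivity)) (fun _ => True)
    choose o ho hoc using fun k => hex k trivial x₀ (hxA k)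
    have hparent : ∀ t, ∃ t', lev t = lev t' + 1 ∧ c t' = p (lev t') (c t) := by
      intro t
      obtain ⟨t', h2, h3⟩ := hex (lev t - 1) trivial (p (lev t - 1) (c t))
        (hp1 _ _ (by simpa using hcA t))
      exact ⟨t', by omega, by rw [h2, h3]⟩
    choose π hπ1 hπ2 using hparent
    have hcA' : ∀ t, c t ∈ A (lev (π t) + 1) := fun t => hπ1 t ▸ hcA t
    have hev := eventually_iterate_eq hr ha ha1 hC hra hπ1 (c := c) (x₀ := x₀) (o := o)
      (fun t => by
        obtain ⟨w, -, h1, h2⟩ := hp2 _ _ (hcA' t)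
        rw [hπ2]
        linarith [dist_triangle (c t) w (p (lev (π t)) (c t))])
      (fun u w hl hlt => by
        have h1 : lev (π u) = lev w := by linarith [hπ1 u]
        refine hinj _ _ h1 ?_
        rw [hπ2, h1]
        exact hp3 _ _ (hl ▸ hcA u) _ (hcA w) (by rwa [one_mul])) ho hoc
    obtain ⟨𝒯, h𝒯π, h𝒯φ, hlev⟩ := exists_refTree_of_unrooted π lev (o 0) (ho 0) hπ1 (by
      intro w v
      obtain ⟨n, hn⟩ := hev w
      obtain ⟨m, hm⟩ := hev v
      -- Both iterates are past their thresholds and land on the same level, hence on the same `o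
      -- k`.
      refine ⟨n + m + (lev w - lev v).toNat, n + m + (lev v - lev w).toNat, ?_⟩
      rw [hn _ (by omega), hm _ (by omega)]
      congr 1
      push_cast
      omega)
    refine ⟨T, 𝒯, c, _, r, a, 3 * γ, CubeSkeleton.of_nets (R := 1) one_pos hr ha ha1 hC hra
      (Q := fun _ => True) (fun _ _ => trivial) hA hp2 hp3 hp4 hinj hQ hcA hex ?_ hlev ?_⟩
    · intro t
      rw [h𝒯π]
      exact Or.inr ⟨hπ1 t, hπ2 t⟩
    · intro t hball
      exact hb (hball ▸ Metric.isBounded_ball)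

theorem mainTheorem2 {X : Type*} [MetricSpace X] [CompleteSpace X] [Nontrivial X]
    (hd : DoublingSpace X) (hu : UniformlyPerfectSpace X) :
    ∃ (T : Type) (𝒯 : RefTree T) (K : T → Set X), 𝒯.IsPartition K ∧ 𝒯.BasicFramework K := by
  have := hd.properSpace
  have := hu.perfectSpace
  obtain ⟨γ, hγ, hu⟩ := hu
  obtain ⟨T, 𝒯, c, R, r, a, C, h⟩ := exists_cubeSkeleton hd hγ hu
  exact ⟨T, 𝒯, CubeSkeleton.cube 𝒯 c R r C, h.isPartition hd hγ hu, h.basicFramework hd hγ hu⟩
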